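/- Let $Y=(0,1)^2$, $J=\begin{pmatrix}0&-1\\1&0\end{pmatrix}$, and let $H^1_\sharp(Y)$ be the space of $Y$-periodic functions in $H^1_{\rm loc}(\mathbb R^2)$. For a $Y$-periodic, bounded, coercive, not necessarily symmetric matrix-valued function $\Sigma$ on $\mathbb R^2$, the effective matrix $\Sigma_*\in\mathbb R^{2\times2}$ is defined by $$\Sigma_*\lambda\cdot\mu=\int_Y\Sigma\nabla W^\lambda\cdot\nabla W^\mu\,dy\qquad(\lambda,\mu\in\mathbb R^2),$$ where $W^\lambda$ is the solution of the cell problem: $W^\lambda-\lambda\cdot y\in H^1_\sharp(Y)$, $\int_Y(W^\lambda-\lambda\cdot y)\,dy=0$, and $\int_Y\Sigma\nabla W^\lambda\cdot\nabla\varphi\,dy=0$ for all $\varphi\in H^1_\sharp(Y)$. Let $\chi_n$ $(n\in\mathbb N)$ be characteristic functions of measurable subsets of $Y$, let $\alpha_1,\alpha_2>0$, $\beta_1,\beta_2\in\mathbb R$, $\alpha_{2,n}>0$ and $\beta_{2,n}\in\mathbb R$ satisfy $$\lim_{n\to\infty}\alpha_{2,n}=\infty,\qquad \liminf_{n\to\infty}|\beta_{2,n}-\beta_1|>0,\qquad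 \lim_{n\to\infty}\frac{\beta_{2,n}}{\alpha_{2,n}}=\frac{\beta_2}{\alpha_2}.$$ For $h\in\mathbb R$ let $(\sigma_n)_*(h)$ be the effective matrix of the $Y$-periodic extension of $$(1-\chi_n)(\alpha_1I_2+h\beta_1J)+\chi_n(\alpha_{2,n}I_2+h\beta_{2,n}J),$$ and for $\gamma_1,\gamma_2>0$ let $(\sigma_n^0)_*(\gamma_1,\gamma_2)$ be the effective matrix of the $Y$-periodic extension of $(1-\chi_n)\gamma_1I_2+\chi_n\gamma_2I_2$. Assume that the sequence $(\sigma_n^0)_*(\gamma_{1,n},\gamma_{2,n})$ is bounded for all positive sequences $\gamma_{1,n},\gamma_{2,n}$ such that $\gamma_{1,n}\to\alpha_1$ and $\gamma_{2,n}/\alpha_{2,n}$ converges to some $\gamma_2>0$. Then, for every $h\in\mathbb R$, there exist positive sequences $\alpha'_{1,n}(h)$, $\alpha'_{2,n}(h)$ such that, as $n\to\infty$, $$\alpha'_{1,n}(h)\to\alpha_1,\qquad \alpha'_{2,n}(h)\sim\frac{\alpha_2^2+h^2\beta_2^2}{\alpha_2^2}\,\alpha_{2,n},$$ the sequence $(\sigma_n^0)_*\big(\alpha'_{1,n}(h),\alpha'_{2,n}(h)\big)$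 is bounded, and $$(\sigma_n)_*(h)=(\sigma_n^0)_*\big(\alpha'_{1,n}(h),\alpha'_{2,n}(h)\big)+h\beta_1J+o(1).$$ -/

import Mathlib

open Filter Topology MeasureTheory Matrix Set

noncomputable section

namespace Hall

/-- The plane `ℝ²`, both for points and for vectors. Only the topology, the Lebesgue measure and the
dot product `⬝ᵥ` are used, never the (sup) norm of the function type. -/
abbrev Plane : Type := Fin 2 → ℝ

/-- The open unit cell `Y = (0,1)²`. -/
def cell : Set Plane := Set.pi Set.univ fun _ => Set.Ioo (0 : ℝ) 1

/-- The rotation matrix `J`. -/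
def rotJ : Matrix (Fin 2) (Fin 2) ℝ := !![0, -1; 1, 0]

/-- The representative of `y` modulo `ℤ²` in `[0,1)²`. -/
def fractPart (y : Plane) : Plane := fun i => Int.fract (y i)

/-- The `Y`-periodic extension to `ℝ²` of `(1 - χ) A₁ + χ A₂`, with `χ` the characteristic function
of the subset `ω` of the cell. -/
def twoPhase (ω : Set Plane) (A₁ A₂ : Matrix (Fin 2) (Fin 2) ℝ) (y : Plane) :
    Matrix (Fin 2) (Fin 2) ℝ :=
  (1 - ω.indicator (fun _ => (1 : ℝ)) (fractPart y)) • A₁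
    + ω.indicator (fun _ => (1 : ℝ)) (fractPart y) • A₂

/-- The conductivity `α I + h β J` of an isotropic phase in the magnetic field `h`. -/
def phase (α β h : ℝ) : Matrix (Fin 2) (Fin 2) ℝ :=
  α • (1 : Matrix (Fin 2) (Fin 2) ℝ) + (h * β) • rotJ

/-- The two-phase conductivity in the absence of a magnetic field,
`(1 - χ) γ₁ I + χ γ₂ I`, extended by periodicity. -/
def fieldFree (ω : Set Plane) (γ₁ γ₂ : ℝ) : Plane → Matrix (Fin 2) (Fin 2) ℝ :=
  twoPhase ω (γ₁ • 1) (γ₂ • 1)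

/-- `u ∈ L²_loc(ℝ²)`. -/
def MemL2Loc (u : Plane → ℝ) : Prop :=
  ∀ K : Set Plane, IsCompact K → MemLp u 2 (volume.restrict K)

/-- `G` is the gradient of `u` in the sense of distributions on `ℝ²`. -/
def HasWeakGradient (u : Plane → ℝ) (G : Plane → Plane) : Prop :=
  ∀ φ : Plane → ℝ, ContDiff ℝ ((⊤ : ℕ∞) : WithTop ℕ∞) φ → HasCompactSupport φ → ∀ i : Fin 2,
    ∫ x, u x * fderiv ℝ φ x (Pi.single i 1) = -∫ x, G x i * φ x

/-- `u` belongs to `H¹_♯(Y)`, the `Y`-periodic functions in `H¹_loc(ℝ²)`, and `G` is its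
gradient. -/
structure IsPeriodicH1 (u : Plane → ℝ) (G : Plane → Plane) : Prop where
  memL2Loc : MemL2Loc u
  memL2Loc_grad : ∀ i : Fin 2, MemL2Loc fun x => G x i
  weakGradient : HasWeakGradient u G
  periodic : ∀ κ : Fin 2 → ℤ, ∀ᵐ x, u (x + fun i => (κ i : ℝ)) = u x

/-- `W`, with gradient `G`, is the solution of the cell problem of `S` in the direction `l`:
`W - l·y` is in `H¹_♯(Y)` with mean zero, and `∫_Y S ∇W · ∇φ = 0` for every `φ ∈ H¹_♯(Y)`. -/
structure IsCorrector (S : Plane → Matrix (Fin 2) (Fin 2) ℝ) (l : Plane)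
    (W : Plane → ℝ) (G : Plane → Plane) : Prop where
  periodicH1 : IsPeriodicH1 (fun y => W y - l ⬝ᵥ y) (fun y => G y - l)
  mean_zero : ∫ y in cell, (W y - l ⬝ᵥ y) = 0
  equation : ∀ (φ : Plane → ℝ) (Φ : Plane → Plane), IsPeriodicH1 φ Φ →
    ∫ y in cell, (S y *ᵥ G y) ⬝ᵥ Φ y = 0

/-- `A` is the effective (homogenized) matrix of the periodic conductivity `S`:
`A l · m = ∫_Y S ∇W^l · ∇W^m` for all `l, m`, where `W^l` solves the cell problem. -/
def IsEffectiveMatrix (S : Plane → Matrix (Fin 2) (Fin 2) ℝ)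
    (A : Matrix (Fin 2) (Fin 2) ℝ) : Prop :=
  ∃ (W : Plane → Plane → ℝ) (G : Plane → Plane → Plane),
    (∀ l, IsCorrector S l (W l) (G l)) ∧
    ∀ l m, (A *ᵥ l) ⬝ᵥ m = ∫ y in cell, (S y *ᵥ G l y) ⬝ᵥ G m y

/-- The effective matrix of `S`; it is characterized by `IsEffectiveMatrix S` whenever the cell
problems of `S` are solvable. -/
def effectiveMatrix (S : Plane → Matrix (Fin 2) (Fin 2) ℝ) : Matrix (Fin 2) (Fin 2) ℝ :=
  Classical.epsilon (IsEffectiveMatrix S)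

/-- A bounded sequence of matrices. -/
def BoundedSeq (A : ℕ → Matrix (Fin 2) (Fin 2) ℝ) : Prop :=
  ∃ C : ℝ, ∀ n i j, |A n i j| ≤ C

end Hall

end

/-! Identify ℝ² with ℂ. The matrix `α I + h β J` becomes multiplication by `α + i h β`, and `J`
becomes multiplication by `i`. In two dimensions a rotated gradient is divergence free, and a
divergence-free periodic field is a constant plus a rotated gradient. So if `g` is a gradient field
with divergence-free flux `f = z g`, then `g + i d f` is again a gradient field and `f + i b g` is
again divergence free, for any real constants `b`, `d`. This pair belongs to the coefficient `z' =
(z + i b) / (1 + i d z)`: this is Dykhne's transformation (`IsMeanPair.dykhne`). On means it acts in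
the same way, which gives an algebraic relation between the two effective matrices.

Subtracting the constant `h β₁ J` makes the first phase the real number `α₁`. With `b = d α₁²` the
transformation fixes `α₁`, and `d` is the small root of a quadratic that makes the second phase
real. Then `A' (1 + d J A) = A + b J`, where `A'` is the effective matrix of a field-free material
and `A` is that of the Hall material minus `h β₁ J`. As `α_{2,n} → ∞`, `d` tends to 0 like
`1/α_{2,n}` or faster and the new second phase is equivalent to `(1 + t²) α_{2,n}` with `t = h β₂ /
α₂`. The hypothesis therefore bounds `A'`, and solving the relation for `A` gives `A - A' → 0`
(`tendsto_sub_of_dykhne`).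

The analysis rests on Fourier series on the cell. They show that a Jacobian has mean zero, give the
Hodge decomposition, and show that gradients form a closed subspace, on which Lax–Milgram solves the
cell problem. -/

namespace Hall

noncomputable section

-- Fourier series on the unit cell

local instance : MeasureSpace UnitAddCircle := ⟨AddCircle.haarAddCircle⟩

local instance : Measure.IsAddHaarMeasure (volume : Measure UnitAddCircle) :=
  inferInstanceAs (Measure.IsAddHaarMeasure AddCircle.haarAddCircle)

local instance : IsProbabilityMeasure (volume : Measure UnitAddCircle) :=
  inferInstanceAs (IsProbabilityMeasure AddCircle.haarAddCircle)

/-- Lebesgue measure on the unit cell. -/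
abbrev cellMeasure : Measure Plane := volume.restrict cell

theorem measurableSet_cell : MeasurableSet cell :=
  MeasurableSet.univ_pi fun _ => measurableSet_Ioo

theorem cellMeasure_eq_restrict_Ioc :
    cellMeasure = volume.restrict {x : Plane | ∀ i, x i ∈ Ioc (0 : ℝ) (0 + 1)} := by
  refine Measure.restrict_congr_set ?_
  have h : {x : Plane | ∀ i, x i ∈ Ioc (0 : ℝ) (0 + 1)} = Set.pi univ fun _ => Ioc (0 : ℝ) 1 := by
    ext x; simp
  rw [h]
  exact Measure.pi_Ioo_ae_eq_pi_Ioc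

instance : IsProbabilityMeasure cellMeasure := by
  refine ⟨?_⟩
  rw [Measure.restrict_apply_univ, cell, volume_pi_pi]
  simp

/-- The point of `(0,1]²` representing a point of the torus. -/
def torusSection (t : UnitAddTorus (Fin 2)) : Plane := fun i => (AddCircle.equivIoc 1 0 (t i)).1

theorem measurePreserving_torusSection :
    MeasurePreserving torusSection volume cellMeasure := by
  rw [cellMeasure_eq_restrict_Ioc]
  have h := UnitAddTorus.measurePreserving_equivPiIoc (d := Fin 2) (fun _ => 0)
  have h2 : MeasurePreserving (Subtype.val : {x : Plane // ∀ i, x i ∈ Ioc (0 : ℝ) (0 + 1)} → Plane)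
      (Measure.comap Subtype.val volume)
      (volume.restrict {x : Plane | ∀ i, x i ∈ Ioc (0 : ℝ) (0 + 1)}) :=
    ⟨measurable_subtype_coe, map_comap_subtype_coe (s := {x : Plane | ∀ i, x i ∈ Ioc (0 : ℝ) (0 + 1)})
      (MeasurableSet.univ_pi' (fun i => measurableSet_Ioc)) volume⟩
  exact h2.comp h

/-- The plane wave `exp (2πi k·x)`. -/
def planeWave (k : Fin 2 → ℤ) (x : Plane) : ℂ :=
  Complex.exp (2 * Real.pi * Complex.I * (k 0 * x 0 + k 1 * x 1))

theorem planeWave_torusSection (k : Fin 2 → ℤ) (t : UnitAddTorus (Fin 2)) :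
    planeWave k (torusSection t) = UnitAddTorus.mFourier k t := by
  have h : ∀ i, t i = ((torusSection t i : ℝ) : UnitAddCircle) := fun i =>
    ((AddCircle.equivIoc 1 0).symm_apply_apply (t i)).symm
  rw [UnitAddTorus.mFourier, ContinuousMap.coe_mk, Fin.prod_univ_two, h 0, h 1]
  rw [fourier_coe_apply, fourier_coe_apply, ← Complex.exp_add, planeWave]
  congr 1
  push_cast
  ring

theorem contDiff_planeWave (k : Fin 2 → ℤ) {n : WithTop ℕ∞} : ContDiff ℝ n (planeWave k) := by
  have h : ∀ i : Fin 2, ContDiff ℝ n fun x : Plane => ((x i : ℝ) : ℂ) := fun i =>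
    Complex.ofRealCLM.contDiff.comp (contDiff_apply ℝ ℝ i)
  unfold planeWave
  have h0 := h 0
  have h1 := h 1
  fun_prop

theorem norm_planeWave (k : Fin 2 → ℤ) (x : Plane) : ‖planeWave k x‖ = 1 := by
  have : planeWave k x = Complex.exp ((2 * Real.pi * (k 0 * x 0 + k 1 * x 1) : ℝ) * Complex.I) := by
    rw [planeWave]; congr 1; push_cast; ring
  rw [this, Complex.norm_exp_ofReal_mul_I]

theorem planeWave_add_int (k : Fin 2 → ℤ) (κ : Fin 2 → ℤ) (x : Plane) :
    planeWave k (x + fun i => (κ i : ℝ)) = planeWave k x := by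
  rw [planeWave, planeWave, Complex.exp_eq_exp_iff_exists_int]
  refine ⟨k 0 * κ 0 + k 1 * κ 1, ?_⟩
  simp only [Pi.add_apply]
  push_cast
  ring

theorem star_planeWave (k : Fin 2 → ℤ) (x : Plane) :
    (starRingEnd ℂ) (planeWave k x) = planeWave (-k) x := by
  rw [planeWave, planeWave, ← Complex.exp_conj]
  congr 1
  simp [map_ofNat (starRingEnd ℂ) 2]
  ring

theorem fderiv_planeWave (k : Fin 2 → ℤ) (x : Plane) (i : Fin 2) :
    fderiv ℝ (planeWave k) x (Pi.single i 1) = 2 * Real.pi * Complex.I * k i * planeWave k x := by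
  have h : ∀ i : Fin 2, HasFDerivAt (fun x : Plane => ((x i : ℝ) : ℂ))
      (Complex.ofRealCLM.comp (ContinuousLinearMap.proj (R := ℝ) (φ := fun _ : Fin 2 => ℝ) i)) x :=
    fun i => Complex.ofRealCLM.hasFDerivAt.comp x (hasFDerivAt_apply i x)
  have h1 := ((((h 0).const_mul (k 0 : ℂ)).add ((h 1).const_mul (k 1 : ℂ))).const_mul
    (2 * Real.pi * Complex.I)).cexp
  have h2 : HasFDerivAt (planeWave k) _ x := h1
  rw [h2.fderiv]
  fin_cases i <;> simp [planeWave] <;> ring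

theorem memLp_planeWave (k : Fin 2 → ℤ) : MemLp (planeWave k) 2 cellMeasure :=
  MemLp.of_bound (contDiff_planeWave k (n := 0)).continuous.aestronglyMeasurable 1
    (Eventually.of_forall fun x => (norm_planeWave k x).le)

/-- The plane waves as elements of `L²`. -/
def planeWaveLp (k : Fin 2 → ℤ) : Lp ℂ 2 cellMeasure := (memLp_planeWave k).toLp _

/-- Composition with the section of the torus. -/
def toTorus : Lp ℂ 2 cellMeasure →ₗᵢ[ℂ] Lp ℂ 2 (volume : Measure (UnitAddTorus (Fin 2))) :=
  Lp.compMeasurePreservingₗᵢ ℂ torusSection measurePreserving_torusSection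

theorem toTorus_planeWaveLp (k : Fin 2 → ℤ) :
    toTorus (planeWaveLp k) = UnitAddTorus.mFourierLp 2 k := by
  refine Lp.ext ?_
  refine (Lp.coeFn_compMeasurePreserving _ measurePreserving_torusSection).trans ?_
  refine EventuallyEq.trans ?_ (UnitAddTorus.coeFn_mFourierLp 2 k).symm
  have h := measurePreserving_torusSection.quasiMeasurePreserving.ae_eq_comp
    (memLp_planeWave k).coeFn_toLp
  refine h.trans (Eventually.of_forall fun t => ?_)
  exact planeWave_torusSection k t

theorem orthonormal_planeWaveLp : Orthonormal ℂ planeWaveLp := by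
  rw [← toTorus.orthonormal_comp_iff]
  have : toTorus ∘ planeWaveLp = UnitAddTorus.mFourierLp 2 := funext toTorus_planeWaveLp
  rw [this]
  exact UnitAddTorus.orthonormal_mFourier

/-- Completeness is inherited from the torus: a function orthogonal to all plane waves pulls back to
one orthogonal to all characters, hence to zero, and the pullback is injective. -/
theorem span_planeWaveLp_orthogonal :
    (Submodule.span ℂ (Set.range planeWaveLp))ᗮ = ⊥ := by
  rw [eq_bot_iff]
  intro f hf
  have h0 : ∀ k, inner ℂ (planeWaveLp k) f = 0 := fun k =>
    (Submodule.mem_orthogonal _ _).1 hf _ (Submodule.subset_span ⟨k, rfl⟩)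
  have h1 : UnitAddTorus.mFourierBasis.repr (toTorus f) = 0 := by
    ext k
    rw [HilbertBasis.repr_apply_apply, UnitAddTorus.coe_mFourierBasis, ← toTorus_planeWaveLp,
      LinearIsometry.inner_map_map, h0]
    rfl
  have h2 : toTorus f = 0 := by simpa using h1
  exact (Submodule.mem_bot ℂ).2 (toTorus.injective (h2.trans (map_zero _).symm))

/-- The plane waves form a Hilbert basis of `L²` of the cell. -/
def fourierBasis : HilbertBasis (Fin 2 → ℤ) ℂ (Lp ℂ 2 cellMeasure) :=
  HilbertBasis.mkOfOrthogonalEqBot orthonormal_planeWaveLp span_planeWaveLp_orthogonal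

theorem fourierBasis_apply (k : Fin 2 → ℤ) : fourierBasis k = planeWaveLp k := by
  rw [fourierBasis, HilbertBasis.coe_mkOfOrthogonalEqBot]

theorem fourierBasis_repr (f : Lp ℂ 2 cellMeasure) (k : Fin 2 → ℤ) :
    fourierBasis.repr f k = ∫ x in cell, planeWave (-k) x * f x := by
  rw [HilbertBasis.repr_apply_apply, fourierBasis_apply, L2.inner_def]
  refine integral_congr_ae ?_
  filter_upwards [(memLp_planeWave k).coeFn_toLp] with x hx
  rw [RCLike.inner_apply, planeWaveLp, hx, star_planeWave, mul_comm]

end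

noncomputable section

/-! ### Lattice translates and periodic extension -/

/-- The integer vector `κ` as a point of the plane. -/
abbrev latticeVec (κ : Fin 2 → ℤ) : Plane := fun i => (κ i : ℝ)

/-- The half-open unit cell with lower left corner `κ`. -/
def latticeCell (κ : Fin 2 → ℤ) : Set Plane := {x | ∀ i, ⌊x i⌋ = κ i}

theorem measurableSet_latticeCell (κ : Fin 2 → ℤ) : MeasurableSet (latticeCell κ) := by
  have : latticeCell κ = ⋂ i, {x : Plane | ⌊x i⌋ = κ i} := by
    ext x; simp [latticeCell]
  rw [this]
  exact MeasurableSet.iInter fun i =>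
    (Int.measurable_floor.comp (measurable_pi_apply i)) (measurableSet_singleton (κ i))

theorem pairwise_disjoint_latticeCell : Pairwise (Function.onFun Disjoint latticeCell) := by
  intro κ κ' h
  refine Set.disjoint_left.2 fun x hx hx' => h ?_
  funext i
  exact (hx i).symm.trans (hx' i)

theorem iUnion_latticeCell : ⋃ κ, latticeCell κ = univ :=
  eq_univ_of_forall fun x => mem_iUnion.2 ⟨fun i => ⌊x i⌋, fun _ => rfl⟩

theorem preimage_add_latticeCell (κ : Fin 2 → ℤ) :
    (fun x => x + latticeVec κ) ⁻¹' latticeCell κ = latticeCell 0 := by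
  ext x
  simp [latticeCell]

theorem cell_ae_eq_latticeCell : cell =ᵐ[volume] latticeCell 0 := by
  have : latticeCell 0 = Set.pi univ fun _ => Ico (0 : ℝ) 1 := by
    ext x; simp [latticeCell, Int.floor_eq_iff]
  rw [this]
  exact (Measure.univ_pi_Ioo_ae_eq_Icc (f := 0) (g := 1)).trans
    (Measure.univ_pi_Ico_ae_eq_Icc (f := 0) (g := 1)).symm

theorem measurableEmbedding_add (c : Plane) : MeasurableEmbedding fun x : Plane => x + c :=
  measurableEmbedding_addRight c

theorem hasSum_integral_cell {E : Type*} [NormedAddCommGroup E] [NormedSpace ℝ E]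
    {f : Plane → E} (hf : Integrable f) :
    HasSum (fun κ : Fin 2 → ℤ => ∫ x in cell, f (x + latticeVec κ)) (∫ x, f x) := by
  have h := hasSum_integral_iUnion measurableSet_latticeCell pairwise_disjoint_latticeCell
    (f := f) hf.integrableOn
  rw [iUnion_latticeCell, setIntegral_univ] at h
  refine h.congr_fun fun κ => ?_
  rw [setIntegral_congr_set cell_ae_eq_latticeCell, ← preimage_add_latticeCell κ]
  exact ((measurePreserving_add_right volume (latticeVec κ)).setIntegral_preimage_emb
    (measurableEmbedding_add _) _ _)

/-- The integral over the plane of the product of a periodic function and a compactly supported one,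
as an integral over the cell. -/
theorem integral_mul_eq_integral_cell {u φ : Plane → ℂ}
    (hu : ∀ κ : Fin 2 → ℤ, ∀ᵐ x, u (x + latticeVec κ) = u x)
    (hint : Integrable fun x => u x * φ x) {S : Finset (Fin 2 → ℤ)}
    (hS : ∀ κ ∉ S, ∀ x ∈ cell, φ (x + latticeVec κ) = 0) :
    ∫ x, u x * φ x = ∫ x in cell, u x * ∑ κ ∈ S, φ (x + latticeVec κ) := by
  have h := hasSum_integral_cell hint
  have h0 : ∀ κ ∉ S, ∫ x in cell, u (x + latticeVec κ) * φ (x + latticeVec κ) = 0 := by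
    intro κ hκ
    rw [setIntegral_congr_fun measurableSet_cell
      (g := fun _ => (0 : ℂ)) (fun x hx => by simp [hS κ hκ x hx])]
    simp
  rw [h.unique (hasSum_sum_of_ne_finset_zero h0)]
  simp_rw [Finset.mul_sum]
  have hc : ∀ κ, (fun x => u (x + latticeVec κ) * φ (x + latticeVec κ)) =ᵐ[cellMeasure]
      fun x => u x * φ (x + latticeVec κ) := fun κ =>
    ae_restrict_of_ae ((hu κ).mono fun x hx => by simp only [hx])
  rw [integral_finsetSum]
  · exact Finset.sum_congr rfl fun κ _ => integral_congr_ae (hc κ)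
  · intro κ _
    exact ((hint.comp_add_right (latticeVec κ)).integrableOn (s := cell)).congr (hc κ)

theorem fractPart_add_latticeVec (κ : Fin 2 → ℤ) (x : Plane) :
    fractPart (x + latticeVec κ) = fractPart x := by
  funext i
  simp [fractPart]

theorem fractPart_of_mem_cell {x : Plane} (hx : x ∈ cell) : fractPart x = x := by
  funext i
  have := hx i (mem_univ i)
  exact Int.fract_eq_self.2 ⟨this.1.le, this.2⟩

theorem measurable_fractPart : Measurable fractPart :=
  measurable_pi_lambda _ fun i => measurable_fract.comp (measurable_pi_apply i)

theorem exists_finset_lattice {K : Set Plane} (hK : Bornology.IsBounded K) :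
    ∃ S : Finset (Fin 2 → ℤ), ∀ κ ∉ S, ∀ x, fractPart x = x → x + latticeVec κ ∉ K := by
  obtain ⟨R, hR⟩ := hK.subset_closedBall 0
  refine ⟨Fintype.piFinset fun _ => Finset.Icc (-⌈R + 1⌉) ⌈R + 1⌉, fun κ hκ x hx hxK => hκ ?_⟩
  rw [Fintype.mem_piFinset]
  intro i
  have h1 : ‖x i + κ i‖ ≤ R := by
    have h2 := hR hxK
    rw [mem_closedBall_zero_iff] at h2
    exact (norm_le_pi_norm (x + latticeVec κ) i).trans h2
  rw [Real.norm_eq_abs, abs_le] at h1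
  have h3 : Int.fract (x i) = x i := congrFun hx i
  have h4 := Int.fract_nonneg (x i)
  have h5 := Int.fract_lt_one (x i)
  have h6 := Int.le_ceil (R + 1)
  rw [Finset.mem_Icc]
  constructor
  · have : (-(⌈R + 1⌉ : ℤ) : ℝ) ≤ κ i := by linarith
    exact_mod_cast this
  · have : (κ i : ℝ) ≤ (⌈R + 1⌉ : ℤ) := by linarith
    exact_mod_cast this

theorem memL2Loc_comp_fractPart {f : Plane → ℝ} (hf : Measurable f) (h : MemLp f 2 cellMeasure) :
    MemL2Loc fun x => f (fractPart x) := by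
  intro K hK
  have hm : Measurable fun x => f (fractPart x) := hf.comp measurable_fractPart
  rw [memLp_two_iff_integrable_sq hm.aestronglyMeasurable]
  rw [memLp_two_iff_integrable_sq hf.aestronglyMeasurable] at h
  obtain ⟨S, hS⟩ := exists_finset_lattice hK.isBounded
  have hcell : IntegrableOn (fun x => f (fractPart x) ^ 2) (latticeCell 0) := by
    refine IntegrableOn.congr_set_ae ?_ cell_ae_eq_latticeCell.symm
    exact IntegrableOn.congr_fun h (fun x hx => by simp [fractPart_of_mem_cell hx])
      measurableSet_cell
  have hκ : ∀ κ, IntegrableOn (fun x => f (fractPart x) ^ 2) (latticeCell κ) := by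
    intro κ
    rw [← (measurePreserving_add_right volume (latticeVec κ)).integrableOn_comp_preimage
      (measurableEmbedding_add _), preimage_add_latticeCell]
    refine hcell.congr_fun (fun x _ => ?_) (measurableSet_latticeCell 0)
    simp [fractPart_add_latticeVec]
  have hU : IntegrableOn (fun x => f (fractPart x) ^ 2) (⋃ κ ∈ S, latticeCell κ) :=
    integrableOn_finset_iUnion.2 fun κ _ => hκ κ
  refine hU.mono_set fun x hx => ?_
  simp only [mem_iUnion]
  refine ⟨fun i => ⌊x i⌋, ?_, fun _ => rfl⟩
  by_contra hn
  refine hS _ hn (fractPart x) (by funext i; simp [fractPart]) ?_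
  convert hx
  funext i
  simp [fractPart]

theorem MemL2Loc.locallyIntegrable {u : Plane → ℝ} (hu : MemL2Loc u) : LocallyIntegrable u := by
  rw [locallyIntegrable_iff]
  intro K hK
  have : IsFiniteMeasure (volume.restrict K) := ⟨by
    rw [Measure.restrict_apply_univ]; exact hK.measure_lt_top⟩
  exact (hu K hK).integrable (by norm_num)

theorem MemL2Loc.memLp_cell {u : Plane → ℝ} (hu : MemL2Loc u) : MemLp u 2 cellMeasure := by
  refine (hu (Set.pi univ fun _ => Icc (0 : ℝ) 1) (isCompact_univ_pi fun _ => isCompact_Icc)).mono_measure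
    (Measure.restrict_mono ?_ le_rfl)
  exact Set.pi_mono fun _ _ => Ioo_subset_Icc_self

theorem MemL2Loc.integrable_mul {u : Plane → ℝ} (hu : MemL2Loc u) {φ : Plane → ℝ}
    (hφ : Continuous φ) (hc : HasCompactSupport φ) : Integrable fun x => u x * φ x := by
  simpa [mul_comm] using hu.locallyIntegrable.integrable_smul_left_of_hasCompactSupport hφ hc

theorem MemL2Loc.integrable_ofReal_mul {u : Plane → ℝ} (hu : MemL2Loc u) {φ : Plane → ℂ}
    (hφ : Continuous φ) (hc : HasCompactSupport φ) : Integrable fun x => (u x : ℂ) * φ x := by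
  simpa using hu.locallyIntegrable.integrable_smul_right_of_hasCompactSupport hφ hc

/-! ### Weak gradients of periodic functions and their Fourier coefficients -/

/-- The Fourier coefficient of a function on the cell. -/
def fourierCoef (f : Plane → ℂ) (k : Fin 2 → ℤ) : ℂ := ∫ x in cell, planeWave (-k) x * f x

theorem isOpen_cell : IsOpen cell := isOpen_set_pi finite_univ fun _ _ => isOpen_Ioo

theorem HasWeakGradient.complex_test {u : Plane → ℝ} {G : Plane → Plane}
    (hu : MemL2Loc u) (hG : ∀ i : Fin 2, MemL2Loc fun x => G x i) (h : HasWeakGradient u G)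
    {ψ : Plane → ℂ} (hψ : ContDiff ℝ ((⊤ : ℕ∞) : WithTop ℕ∞) ψ) (hc : HasCompactSupport ψ)
    (i : Fin 2) :
    ∫ x, (u x : ℂ) * fderiv ℝ ψ x (Pi.single i 1) = -∫ x, (G x i : ℂ) * ψ x := by
  have hd : Continuous fun x => fderiv ℝ ψ x (Pi.single i 1) :=
    (hψ.continuous_fderiv (by simp)).clm_apply continuous_const
  have hdc : HasCompactSupport fun x => fderiv ℝ ψ x (Pi.single i 1) :=
    hc.fderiv_apply ℝ (Pi.single i 1)
  have hi1 := hu.integrable_ofReal_mul hd hdc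
  have hi2 := (hG i).integrable_ofReal_mul hψ.continuous hc
  -- Composing `ψ` with a real-linear functional gives an admissible real test function; the real
  -- and imaginary parts are the two cases needed.
  have key : ∀ L : ℂ →L[ℝ] ℝ, L (∫ x, (u x : ℂ) * fderiv ℝ ψ x (Pi.single i 1))
      = L (-∫ x, (G x i : ℂ) * ψ x) := by
    intro L
    have h1 := h (fun x => L (ψ x)) (L.contDiff.comp hψ) (hc.comp_left (map_zero L)) i
    rw [map_neg, ← L.integral_comp_comm hi1, ← L.integral_comp_comm hi2]
    have e1 : ∀ (a : ℝ) (z : ℂ), L ((a : ℂ) * z) = a * L z := fun a z => by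
      rw [← Complex.real_smul, map_smul, smul_eq_mul]
    simp only [e1]
    rw [← h1]
    refine integral_congr_ae (Eventually.of_forall fun x => ?_)
    have hx : HasFDerivAt (fun x => L (ψ x)) (L.comp (fderiv ℝ ψ x)) x :=
      L.hasFDerivAt.comp x ((hψ.differentiable (by simp)) x).hasFDerivAt
    simp only [hx.fderiv, ContinuousLinearMap.comp_apply]
  exact Complex.ext (key Complex.reCLM) (key Complex.imCLM)

/-- Periodicity is only required of the function. Its gradient inherits it because weak gradients
are unique almost everywhere and translation preserves the weak formulation. -/
theorem IsPeriodicH1.periodic_grad {u : Plane → ℝ} {G : Plane → Plane} (h : IsPeriodicH1 u G)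
    (κ : Fin 2 → ℤ) (i : Fin 2) : ∀ᵐ x, G (x + latticeVec κ) i = G x i := by
  have hl := (h.memL2Loc_grad i).locallyIntegrable
  have hl' : LocallyIntegrable fun x => G (x + latticeVec κ) i := by
    rw [locallyIntegrable_iff]
    intro K hK
    have h1 := (locallyIntegrable_iff.1 hl) ((fun x => x + latticeVec κ) '' K)
      (hK.image (by fun_prop))
    rw [← (measurePreserving_add_right volume (latticeVec κ)).integrableOn_comp_preimage
      (measurableEmbedding_add _)] at h1
    rwa [preimage_image_eq _ (add_left_injective _)] at h1
  refine ae_eq_of_integral_contDiff_smul_eq hl' hl fun φ hφ hc => ?_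
  simp only [smul_eq_mul]
  have e1 : ∫ x, φ x * G (x + latticeVec κ) i = ∫ x, G x i * φ (x - latticeVec κ) := by
    rw [← integral_add_right_eq_self (fun x => G x i * φ (x - latticeVec κ)) (latticeVec κ)]
    simp [mul_comm]
  have hφ' : ContDiff ℝ ((⊤ : ℕ∞) : WithTop ℕ∞) fun x => φ (x - latticeVec κ) :=
    hφ.comp (contDiff_id.sub contDiff_const)
  have hc' : HasCompactSupport fun x => φ (x - latticeVec κ) :=
    hc.comp_homeomorph (Homeomorph.subRight (latticeVec κ))
  have h1 := h.weakGradient _ hφ' hc' i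
  have h2 := h.weakGradient _ hφ hc i
  have h3 : ∫ x, u x * fderiv ℝ (fun x => φ (x - latticeVec κ)) x (Pi.single i 1)
      = ∫ x, u x * fderiv ℝ φ x (Pi.single i 1) := by
    rw [← integral_add_right_eq_self _ (latticeVec κ)]
    refine integral_congr_ae ((h.periodic κ).mono fun x hx => ?_)
    have hx' : u (x + latticeVec κ) = u x := hx
    simp only [hx']
    rw [fderiv_comp_sub, add_sub_cancel_right]
  rw [e1, ← neg_inj, ← h1, h3, h2]
  simp [mul_comm]

/-- A smooth function of one variable whose integer translates add up to `1`. -/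
def partitionBump (t : ℝ) : ℝ := Real.smoothTransition (t + 1) - Real.smoothTransition t

theorem partitionBump_eq_zero {t : ℝ} (h : t ≤ -1 ∨ 1 ≤ t) : partitionBump t = 0 := by
  rcases h with h | h
  · rw [partitionBump, Real.smoothTransition.zero_of_nonpos (by linarith),
      Real.smoothTransition.zero_of_nonpos (by linarith), sub_zero]
  · rw [partitionBump, Real.smoothTransition.one_of_one_le (by linarith),
      Real.smoothTransition.one_of_one_le h, sub_self]

theorem partitionBump_add {t : ℝ} (h : t ∈ Ioo (0 : ℝ) 1) :
    partitionBump (t + (-1 : ℤ)) + partitionBump (t + (0 : ℤ)) = 1 := by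
  have h1 := Real.smoothTransition.one_of_one_le (x := t + 1) (by linarith [h.1])
  have h2 := Real.smoothTransition.zero_of_nonpos (x := t + -1) (by linarith [h.2])
  simp [partitionBump, h1, h2]

theorem contDiff_partitionBump {n : ℕ∞} : ContDiff ℝ n partitionBump :=
  (Real.smoothTransition.contDiff.comp (contDiff_id.add contDiff_const)).sub
    Real.smoothTransition.contDiff

/-- A smooth compactly supported function whose integer translates add up to `1`. -/
def partitionBump₂ (x : Plane) : ℝ := ∏ i, partitionBump (x i)

theorem contDiff_partitionBump₂ : ContDiff ℝ ((⊤ : ℕ∞) : WithTop ℕ∞) partitionBump₂ :=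
  contDiff_prod fun i _ => contDiff_partitionBump.comp (contDiff_apply ℝ ℝ i)

theorem hasCompactSupport_partitionBump₂ : HasCompactSupport partitionBump₂ := by
  refine HasCompactSupport.intro (K := Set.pi univ fun _ => Icc (-1 : ℝ) 1)
    (isCompact_univ_pi fun _ => isCompact_Icc) fun x hx => ?_
  simp only [Set.mem_pi, mem_univ, true_imp_iff, not_forall, mem_Icc, not_and_or, not_le] at hx
  obtain ⟨i, hi⟩ := hx
  exact Finset.prod_eq_zero (Finset.mem_univ i)
    (partitionBump_eq_zero (hi.imp le_of_lt le_of_lt))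

/-- The lattice points whose translates of the support of `partitionBump₂` meet the cell. -/
def bumpShifts : Finset (Fin 2 → ℤ) := Fintype.piFinset fun _ => {-1, 0}

theorem partitionBump₂_eq_zero {κ : Fin 2 → ℤ} (hκ : κ ∉ bumpShifts) {x : Plane} (hx : x ∈ cell) :
    partitionBump₂ (x + latticeVec κ) = 0 := by
  simp only [bumpShifts, Fintype.mem_piFinset, not_forall, Finset.mem_insert,
    Finset.mem_singleton, not_or] at hκ
  obtain ⟨i, h1, h2⟩ := hκ
  refine Finset.prod_eq_zero (Finset.mem_univ i) (partitionBump_eq_zero ?_)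
  have hxi := hx i (mem_univ i)
  simp only [Pi.add_apply]
  rcases lt_or_ge (κ i) 0 with h | h
  · left
    have : (κ i : ℝ) ≤ (-2 : ℤ) := by exact_mod_cast (by omega : κ i ≤ -2)
    push_cast at this
    linarith [hxi.2]
  · right
    have : ((1 : ℤ) : ℝ) ≤ κ i := by exact_mod_cast (by omega : 1 ≤ κ i)
    push_cast at this
    linarith [hxi.1]

theorem sum_partitionBump₂ {x : Plane} (hx : x ∈ cell) :
    ∑ κ ∈ bumpShifts, partitionBump₂ (x + latticeVec κ) = 1 := by
  have h := Finset.prod_univ_sum (fun _ : Fin 2 => ({-1, 0} : Finset ℤ))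
    (fun i a => partitionBump (x i + (a : ℝ)))
  have h2 : ∀ i : Fin 2, ∑ a ∈ ({-1, 0} : Finset ℤ), partitionBump (x i + (a : ℝ)) = 1 := by
    intro i
    rw [Finset.sum_pair (by norm_num)]
    exact partitionBump_add (hx i (mem_univ i))
  simp only [h2, Finset.prod_const_one] at h
  exact h.symm

/-- A plane wave is not compactly supported, so the test function is a plane wave times
`partitionBump₂`. Folding the integrals onto the cell sums the translates of the bump to 1 and
leaves the bare plane wave. -/
theorem IsPeriodicH1.fourierCoef_grad {u : Plane → ℝ} {G : Plane → Plane} (h : IsPeriodicH1 u G)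
    (k : Fin 2 → ℤ) (i : Fin 2) :
    fourierCoef (fun x => (G x i : ℂ)) k
      = 2 * Real.pi * Complex.I * k i * fourierCoef (fun x => (u x : ℂ)) k := by
  set ψ : Plane → ℂ := fun x => (partitionBump₂ x : ℂ) * planeWave (-k) x with hψdef
  have hψ : ContDiff ℝ ((⊤ : ℕ∞) : WithTop ℕ∞) ψ :=
    (Complex.ofRealCLM.contDiff.comp contDiff_partitionBump₂).mul (contDiff_planeWave _)
  have hc : HasCompactSupport ψ :=
    (hasCompactSupport_partitionBump₂.comp_left (g := ((↑) : ℝ → ℂ)) Complex.ofReal_zero).mul_right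
  have hw := h.weakGradient.complex_test h.memL2Loc h.memL2Loc_grad hψ hc i
  have hz : ∀ κ ∉ bumpShifts, ∀ x ∈ cell, ψ (x + latticeVec κ) = 0 := fun κ hκ x hx => by
    simp [hψdef, partitionBump₂_eq_zero hκ hx]
  have hdz : ∀ κ ∉ bumpShifts, ∀ x ∈ cell,
      fderiv ℝ ψ (x + latticeVec κ) (Pi.single i 1) = 0 := fun κ hκ x hx => by
    rw [← fderiv_comp_add_right]
    have : (fun y => ψ (y + latticeVec κ)) =ᶠ[𝓝 x] fun _ => 0 := by
      filter_upwards [isOpen_cell.mem_nhds hx] with y hy using hz κ hκ y hy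
    rw [this.fderiv_eq]
    simp
  have hs : ∀ x ∈ cell, ∑ κ ∈ bumpShifts, ψ (x + latticeVec κ) = planeWave (-k) x := by
    intro x hx
    simp only [hψdef, planeWave_add_int, ← Finset.sum_mul]
    rw [← Complex.ofReal_sum, sum_partitionBump₂ hx, Complex.ofReal_one, one_mul]
  have hds : ∀ x ∈ cell, ∑ κ ∈ bumpShifts, fderiv ℝ ψ (x + latticeVec κ) (Pi.single i 1)
      = -(2 * Real.pi * Complex.I * k i) * planeWave (-k) x := by
    intro x hx
    have e : (fun y => ∑ κ ∈ bumpShifts, ψ (y + latticeVec κ)) =ᶠ[𝓝 x] planeWave (-k) := by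
      filter_upwards [isOpen_cell.mem_nhds hx] with y hy using hs y hy
    have e2 := e.fderiv_eq (𝕜 := ℝ)
    have hdiff : ∀ κ ∈ bumpShifts, DifferentiableAt ℝ (fun y => ψ (y + latticeVec κ)) x :=
      fun κ _ => (hψ.differentiable (by simp)).differentiableAt.comp x
        (differentiableAt_id.add_const _)
    rw [fderiv_fun_sum hdiff] at e2
    have e3 := congrArg (fun L => L (Pi.single i 1)) e2
    simp only [_root_.sum_apply, fderiv_planeWave] at e3
    simp only [fderiv_comp_add_right] at e3
    rw [e3]
    simp
  have hd : Continuous fun x => fderiv ℝ ψ x (Pi.single i 1) :=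
    (hψ.continuous_fderiv (by simp)).clm_apply continuous_const
  have hdc : HasCompactSupport fun x => fderiv ℝ ψ x (Pi.single i 1) :=
    hc.fderiv_apply ℝ (Pi.single i 1)
  rw [integral_mul_eq_integral_cell (fun κ => (h.periodic κ).mono fun x hx => by
      exact congrArg Complex.ofReal hx) (h.memL2Loc.integrable_ofReal_mul hd hdc) hdz,
    integral_mul_eq_integral_cell (fun κ => (h.periodic_grad κ i).mono fun x hx => by
      exact congrArg Complex.ofReal hx)
      ((h.memL2Loc_grad i).integrable_ofReal_mul hψ.continuous hc) hz,
    setIntegral_congr_fun measurableSet_cell (fun x hx => by simp only [hds x hx]; rfl),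
    setIntegral_congr_fun (f := fun x => (G x i : ℂ) * _) measurableSet_cell
      (fun x hx => by simp only [hs x hx]; rfl)] at hw
  rw [fourierCoef, fourierCoef, ← integral_const_mul, ← neg_inj]
  simp only [mul_comm (planeWave (-k) _)]
  rw [← hw, ← integral_neg]
  congr 1
  funext x
  ring

theorem measurable_re_coeFn (w : Lp ℂ 2 cellMeasure) : Measurable fun x => (w x).re :=
  Complex.measurable_re.comp (Lp.stronglyMeasurable w).measurable

theorem measurable_im_coeFn (w : Lp ℂ 2 cellMeasure) : Measurable fun x => (w x).im :=
  Complex.measurable_im.comp (Lp.stronglyMeasurable w).measurable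

theorem memL2Loc_re (w : Lp ℂ 2 cellMeasure) : MemL2Loc fun x => (w (fractPart x)).re :=
  memL2Loc_comp_fractPart (measurable_re_coeFn w) (Lp.memLp w).re

theorem memL2Loc_im (w : Lp ℂ 2 cellMeasure) : MemL2Loc fun x => (w (fractPart x)).im :=
  memL2Loc_comp_fractPart (measurable_im_coeFn w) (Lp.memLp w).im

theorem integrable_comp_fractPart_mul (w : Lp ℂ 2 cellMeasure) {φ : Plane → ℂ}
    (hφ : Continuous φ) (hc : HasCompactSupport φ) :
    Integrable fun x => w (fractPart x) * φ x := by
  have h1 := (memL2Loc_re w).integrable_ofReal_mul hφ hc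
  have h2 := ((memL2Loc_im w).integrable_ofReal_mul hφ hc).const_mul Complex.I
  refine (h1.add h2).congr (Eventually.of_forall fun x => ?_)
  have hx := Complex.re_add_im (w (fractPart x))
  simp only [Pi.add_apply]
  linear_combination φ x * hx

theorem memLp_sum_translates {φ : Plane → ℂ} (hφ : Continuous φ) (hc : HasCompactSupport φ)
    (S : Finset (Fin 2 → ℤ)) :
    MemLp (fun x => ∑ κ ∈ S, φ (x + latticeVec κ)) 2 cellMeasure := by
  obtain ⟨C, hC⟩ := hc.exists_bound_of_continuous hφ
  refine memLp_finsetSum S fun κ _ => ?_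
  exact MemLp.of_bound (hφ.comp (by fun_prop)).aestronglyMeasurable C
    (Eventually.of_forall fun x => hC _)

/-- Parseval's identity on the cell. -/
theorem tsum_integral_planeWave_mul {Q : Plane → ℂ} (hQ : MemLp Q 2 cellMeasure)
    (w : Lp ℂ 2 cellMeasure) :
    ∑' k, (∫ x in cell, planeWave k x * Q x) * fourierBasis.repr w k = ∫ x in cell, w x * Q x := by
  have hQ' : MemLp (fun x => (starRingEnd ℂ) (Q x)) 2 cellMeasure := hQ.star
  have h := fourierBasis.tsum_inner_mul_inner (hQ'.toLp _) w
  have e1 : ∀ f : Lp ℂ 2 cellMeasure, inner ℂ (hQ'.toLp _) f = ∫ x in cell, f x * Q x := by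
    intro f
    rw [L2.inner_def]
    refine integral_congr_ae ?_
    filter_upwards [hQ'.coeFn_toLp] with x hx
    rw [hx, RCLike.inner_apply, Complex.conj_conj]
  rw [e1] at h
  rw [← h]
  refine tsum_congr fun k => ?_
  rw [e1, HilbertBasis.repr_apply_apply, fourierBasis_apply]
  congr 1
  refine integral_congr_ae ?_
  filter_upwards [(memLp_planeWave k).coeFn_toLp] with x hx
  rw [planeWaveLp, hx]

theorem integral_planeWave_mul_fderiv (k : Fin 2 → ℤ) (i : Fin 2) {φ : Plane → ℂ}
    (hφ : ContDiff ℝ ((⊤ : ℕ∞) : WithTop ℕ∞) φ) (hc : HasCompactSupport φ) :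
    ∫ x, planeWave k x * fderiv ℝ φ x (Pi.single i 1)
      = -(2 * Real.pi * Complex.I * k i * ∫ x, planeWave k x * φ x) := by
  have hw : Continuous (planeWave k) := (contDiff_planeWave k (n := 0)).continuous
  have hd : Continuous fun x => fderiv ℝ φ x (Pi.single i 1) :=
    (hφ.continuous_fderiv (by simp)).clm_apply continuous_const
  have hdc : HasCompactSupport fun x => fderiv ℝ φ x (Pi.single i 1) :=
    hc.fderiv_apply ℝ (Pi.single i 1)
  have hi : Integrable fun x => planeWave k x * φ x :=
    (hw.mul hφ.continuous).integrable_of_hasCompactSupport hc.mul_left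
  rw [integral_mul_fderiv_eq_neg_fderiv_mul_of_integrable]
  · simp only [fderiv_planeWave, mul_assoc, integral_const_mul]
  · simp only [fderiv_planeWave, mul_assoc]
    exact ((((hi.const_mul _).const_mul _).const_mul _).const_mul _)
  · exact (hw.mul hd).integrable_of_hasCompactSupport hdc.mul_left
  · exact hi
  · exact fun x _ => (contDiff_planeWave k (n := 1)).differentiable (by simp) x
  · exact fun x _ => hφ.differentiable (by simp) x

/-- A function whose Fourier coefficients are those of a gradient field has the field as its weak
gradient, once both are extended by periodicity. -/
theorem integral_comp_fractPart_mul_fderiv {u v : Lp ℂ 2 cellMeasure} {i : Fin 2}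
    (h : ∀ k, fourierBasis.repr v k = 2 * Real.pi * Complex.I * k i * fourierBasis.repr u k)
    {φ : Plane → ℂ} (hφ : ContDiff ℝ ((⊤ : ℕ∞) : WithTop ℕ∞) φ) (hc : HasCompactSupport φ) :
    ∫ x, u (fractPart x) * fderiv ℝ φ x (Pi.single i 1) = -∫ x, v (fractPart x) * φ x := by
  have hd : Continuous fun x => fderiv ℝ φ x (Pi.single i 1) :=
    (hφ.continuous_fderiv (by simp)).clm_apply continuous_const
  have hdc : HasCompactSupport fun x => fderiv ℝ φ x (Pi.single i 1) :=
    hc.fderiv_apply ℝ (Pi.single i 1)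
  obtain ⟨S, hS⟩ := exists_finset_lattice hc.isBounded
  have hz : ∀ κ ∉ S, ∀ x ∈ cell, φ (x + latticeVec κ) = 0 := fun κ hκ x hx =>
    image_eq_zero_of_notMem_tsupport (hS κ hκ x (fractPart_of_mem_cell hx))
  have hdz : ∀ κ ∉ S, ∀ x ∈ cell, fderiv ℝ φ (x + latticeVec κ) (Pi.single i 1) = 0 :=
    fun κ hκ x hx => by
      rw [fderiv_of_notMem_tsupport ℝ (hS κ hκ x (fractPart_of_mem_cell hx))]
      rfl
  have hper : ∀ (w : Lp ℂ 2 cellMeasure) (κ : Fin 2 → ℤ),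
      ∀ᵐ x, w (fractPart (x + latticeVec κ)) = w (fractPart x) := fun w κ =>
    Eventually.of_forall fun x => by rw [fractPart_add_latticeVec]
  have hcell : ∀ (w : Lp ℂ 2 cellMeasure) (Q : Plane → ℂ),
      ∫ x in cell, w (fractPart x) * Q x = ∫ x in cell, w x * Q x := fun w Q =>
    setIntegral_congr_fun measurableSet_cell fun x hx => by
      simp only [fractPart_of_mem_cell hx]
  have hw : ∀ k, Continuous (planeWave k) := fun k => (contDiff_planeWave k (n := 0)).continuous
  -- Both sides are folded onto the cell and expanded by Parseval, which reduces the claim to one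
  -- plane wave at a time.
  rw [integral_mul_eq_integral_cell (hper u) (integrable_comp_fractPart_mul u hd hdc) hdz,
    integral_mul_eq_integral_cell (hper v) (integrable_comp_fractPart_mul v hφ.continuous hc) hz,
    hcell, hcell, ← tsum_integral_planeWave_mul (memLp_sum_translates hd hdc S),
    ← tsum_integral_planeWave_mul (memLp_sum_translates hφ.continuous hc S), ← tsum_neg]
  refine tsum_congr fun k => ?_
  -- Each coefficient is unfolded to the plane again, where the claim is integration by parts
  -- against a smooth wave.
  rw [← integral_mul_eq_integral_cell (fun κ => Eventually.of_forall (planeWave_add_int k κ))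
      (((hw k).mul hd).integrable_of_hasCompactSupport hdc.mul_left) hdz,
    ← integral_mul_eq_integral_cell (fun κ => Eventually.of_forall (planeWave_add_int k κ))
      (((hw k).mul hφ.continuous).integrable_of_hasCompactSupport hc.mul_left) hz,
    integral_planeWave_mul_fderiv k i hφ hc, h]
  ring

theorem isPeriodicH1_re {u : Lp ℂ 2 cellMeasure} {v : Fin 2 → Lp ℂ 2 cellMeasure}
    (h : ∀ i k, fourierBasis.repr (v i) k
      = 2 * Real.pi * Complex.I * k i * fourierBasis.repr u k) :
    IsPeriodicH1 (fun x => (u (fractPart x)).re) (fun x i => (v i (fractPart x)).re) where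
  memL2Loc := memL2Loc_re u
  memL2Loc_grad i := memL2Loc_re (v i)
  periodic κ := Eventually.of_forall fun x => by rw [fractPart_add_latticeVec κ x]
  weakGradient := by
    intro φ hφ hc i
    have hφ' : ContDiff ℝ ((⊤ : ℕ∞) : WithTop ℕ∞) fun x => (φ x : ℂ) :=
      Complex.ofRealCLM.contDiff.comp hφ
    have hc' : HasCompactSupport fun x => (φ x : ℂ) :=
      hc.comp_left (g := ((↑) : ℝ → ℂ)) Complex.ofReal_zero
    have hd : Continuous fun x => fderiv ℝ (fun x => (φ x : ℂ)) x (Pi.single i 1) :=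
      (hφ'.continuous_fderiv (by simp)).clm_apply continuous_const
    have hdc : HasCompactSupport fun x => fderiv ℝ (fun x => (φ x : ℂ)) x (Pi.single i 1) :=
      hc'.fderiv_apply ℝ (Pi.single i 1)
    have key := congrArg Complex.reCLM (integral_comp_fractPart_mul_fderiv (h i) hφ' hc')
    rw [map_neg, ← Complex.reCLM.integral_comp_comm (integrable_comp_fractPart_mul u hd hdc),
      ← Complex.reCLM.integral_comp_comm
        (integrable_comp_fractPart_mul (v i) hφ'.continuous hc')] at key
    have hder : ∀ x, fderiv ℝ (fun x => (φ x : ℂ)) x (Pi.single i 1)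
        = ((fderiv ℝ φ x (Pi.single i 1) : ℝ) : ℂ) := fun x => by
      have hx : HasFDerivAt (fun x => (φ x : ℂ)) (Complex.ofRealCLM.comp (fderiv ℝ φ x)) x :=
        Complex.ofRealCLM.hasFDerivAt.comp x ((hφ.differentiable (by simp)) x).hasFDerivAt
      rw [hx.fderiv]
      rfl
    simpa [hder] using key

/-! ### Gradient fields and the Hodge decomposition -/

/-- Square integrable vector fields on the cell, with `ℝ²` identified with `ℂ`. -/
abbrev FieldSpace : Type := Lp ℂ 2 cellMeasure

/-- The identification of the plane with `ℂ`. -/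
def toC (x : Plane) : ℂ := ⟨x 0, x 1⟩

theorem toC_add (x y : Plane) : toC (x + y) = toC x + toC y := rfl

theorem toC_smul (r : ℝ) (x : Plane) : toC (r • x) = r • toC x := by
  apply Complex.ext <;> simp [toC]

theorem toC_eq (x : Plane) : toC x = (x 0 : ℂ) + Complex.I * (x 1 : ℂ) := by
  apply Complex.ext <;> simp [toC]

theorem inner_toC (x y : Plane) : inner ℝ (toC x) (toC y) = x ⬝ᵥ y := by
  simp [Complex.inner, toC, dotProduct, Fin.sum_univ_two, mul_comm]

theorem IsPeriodicH1.memLp_grad_ofReal {u : Plane → ℝ} {G : Plane → Plane} (h : IsPeriodicH1 u G)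
    (i : Fin 2) : MemLp (fun x => (G x i : ℂ)) 2 cellMeasure := (h.memL2Loc_grad i).memLp_cell.ofReal

theorem IsPeriodicH1.memLp_toC {u : Plane → ℝ} {G : Plane → Plane} (h : IsPeriodicH1 u G) :
    MemLp (fun x => toC (G x)) 2 cellMeasure := by
  simp only [toC_eq]
  exact (h.memLp_grad_ofReal 0).add ((h.memLp_grad_ofReal 1).const_mul Complex.I)

theorem IsPeriodicH1.zero : IsPeriodicH1 0 0 where
  memL2Loc _ _ := MemLp.zero
  memL2Loc_grad _ _ _ := MemLp.zero
  weakGradient _ _ _ _ := by simp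
  periodic _ := by simp

theorem IsPeriodicH1.add {u v : Plane → ℝ} {G H : Plane → Plane} (h : IsPeriodicH1 u G)
    (h' : IsPeriodicH1 v H) : IsPeriodicH1 (u + v) (G + H) where
  memL2Loc K hK := (h.memL2Loc K hK).add (h'.memL2Loc K hK)
  memL2Loc_grad i K hK := (h.memL2Loc_grad i K hK).add (h'.memL2Loc_grad i K hK)
  weakGradient φ hφ hc i := by
    have hd : Continuous fun x => fderiv ℝ φ x (Pi.single i 1) :=
      (hφ.continuous_fderiv (by simp)).clm_apply continuous_const
    have hdc : HasCompactSupport fun x => fderiv ℝ φ x (Pi.single i 1) :=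
      hc.fderiv_apply ℝ (Pi.single i 1)
    simp only [Pi.add_apply, add_mul]
    rw [integral_add (h.memL2Loc.integrable_mul hd hdc) (h'.memL2Loc.integrable_mul hd hdc),
      integral_add ((h.memL2Loc_grad i).integrable_mul hφ.continuous hc)
        ((h'.memL2Loc_grad i).integrable_mul hφ.continuous hc),
      h.weakGradient φ hφ hc i, h'.weakGradient φ hφ hc i]
    ring
  periodic κ := by
    filter_upwards [h.periodic κ, h'.periodic κ] with x h1 h2
    simp only [Pi.add_apply, h1, h2]

theorem IsPeriodicH1.smul {u : Plane → ℝ} {G : Plane → Plane} (h : IsPeriodicH1 u G) (r : ℝ) :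
    IsPeriodicH1 (r • u) (r • G) where
  memL2Loc K hK := (h.memL2Loc K hK).const_smul r
  memL2Loc_grad i K hK := (h.memL2Loc_grad i K hK).const_smul r
  weakGradient φ hφ hc i := by
    simp only [Pi.smul_apply, smul_eq_mul, mul_assoc, integral_const_mul]
    rw [h.weakGradient φ hφ hc i]
    ring
  periodic κ := by
    filter_upwards [h.periodic κ] with x h1
    simp only [Pi.smul_apply, h1]

/-- Subtracting a constant does not change the gradient. -/
theorem IsPeriodicH1.sub_const {u : Plane → ℝ} {G : Plane → Plane} (h : IsPeriodicH1 u G) (c : ℝ) :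
    IsPeriodicH1 (fun x => u x - c) G where
  memL2Loc K hK := by
    have : IsFiniteMeasure (volume.restrict K) := ⟨by
      rw [Measure.restrict_apply_univ]; exact hK.measure_lt_top⟩
    exact (h.memL2Loc K hK).sub (memLp_const c)
  memL2Loc_grad := h.memL2Loc_grad
  weakGradient φ hφ hc i := by
    have hd : Continuous fun x => fderiv ℝ φ x (Pi.single i 1) :=
      (hφ.continuous_fderiv (by simp)).clm_apply continuous_const
    have hdc : HasCompactSupport fun x => fderiv ℝ φ x (Pi.single i 1) :=
      hc.fderiv_apply ℝ (Pi.single i 1)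
    have h0 : ∫ x, fderiv ℝ φ x (Pi.single i 1) = 0 := by
      have := integral_mul_fderiv_eq_neg_fderiv_mul_of_integrable (μ := (volume : Measure Plane))
        (𝕜 := ℝ) (f := fun _ : Plane => (1 : ℝ)) (g := φ) (v := Pi.single i 1) (by simp)
        (by simpa using hd.integrable_of_hasCompactSupport hdc)
        (by simpa using hφ.continuous.integrable_of_hasCompactSupport hc)
        (fun x _ => by fun_prop) (fun x _ => hφ.differentiable (by simp) x)
      simpa using this
    simp only [sub_mul]
    rw [integral_sub (h.memL2Loc.integrable_mul hd hdc)
      ((hd.integrable_of_hasCompactSupport hdc).const_mul c), integral_const_mul, h0, mul_zero,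
      sub_zero, h.weakGradient φ hφ hc i]
  periodic κ := by
    filter_upwards [h.periodic κ] with x h1
    rw [h1]

/-- The gradients of the functions of `H¹_♯(Y)`. -/
def gradSpace : Submodule ℝ FieldSpace where
  carrier := {g | ∃ u G, IsPeriodicH1 u G ∧ g =ᵐ[cellMeasure] fun x => toC (G x)}
  zero_mem' := ⟨0, 0, IsPeriodicH1.zero, by
    filter_upwards [Lp.coeFn_zero ℂ 2 cellMeasure] with x hx
    rw [hx]; rfl⟩
  add_mem' := by
    rintro f g ⟨u, G, h, hf⟩ ⟨v, H, h', hg⟩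
    refine ⟨u + v, G + H, h.add h', ?_⟩
    filter_upwards [Lp.coeFn_add f g, hf, hg] with x h1 h2 h3
    rw [h1, Pi.add_apply, h2, h3, Pi.add_apply, toC_add]
  smul_mem' := by
    rintro r f ⟨u, G, h, hf⟩
    refine ⟨r • u, r • G, h.smul r, ?_⟩
    filter_upwards [Lp.coeFn_smul r f, hf] with x h1 h2
    rw [h1, Pi.smul_apply, h2, Pi.smul_apply, toC_smul]

theorem IsPeriodicH1.toLp_mem_gradSpace {u : Plane → ℝ} {G : Plane → Plane}
    (h : IsPeriodicH1 u G) : h.memLp_toC.toLp _ ∈ gradSpace := ⟨u, G, h, h.memLp_toC.coeFn_toLp⟩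

theorem fourierBasis_repr_toLp {f : Plane → ℂ} (hf : MemLp f 2 cellMeasure) (k : Fin 2 → ℤ) :
    fourierBasis.repr (hf.toLp f) k = fourierCoef f k := by
  rw [fourierBasis_repr, fourierCoef]
  refine integral_congr_ae ?_
  filter_upwards [hf.coeFn_toLp] with x hx
  rw [hx]

theorem IsPeriodicH1.integral_grad {u : Plane → ℝ} {G : Plane → Plane} (h : IsPeriodicH1 u G)
    (i : Fin 2) : ∫ x in cell, G x i = 0 := by
  have h0 := h.fourierCoef_grad 0 i
  simp only [fourierCoef, neg_zero, Pi.zero_apply, Int.cast_zero, mul_zero, zero_mul] at h0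
  have h1 : ∀ x, planeWave 0 x = 1 := fun x => by simp [planeWave]
  simp only [h1, one_mul] at h0
  rw [integral_complex_ofReal] at h0
  exact_mod_cast h0

/-- The Jacobian determinant is a null Lagrangian. -/
theorem IsPeriodicH1.integral_grad_mul_grad {u v : Plane → ℝ} {G H : Plane → Plane}
    (h : IsPeriodicH1 u G) (h' : IsPeriodicH1 v H) :
    ∫ x in cell, G x 0 * H x 1 = ∫ x in cell, G x 1 * H x 0 := by
  have key : ∀ i j, ((∫ x in cell, G x i * H x j : ℝ) : ℂ)
      = inner ℂ ((h.memLp_grad_ofReal i).toLp _) ((h'.memLp_grad_ofReal j).toLp _) := by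
    intro i j
    rw [← integral_complex_ofReal, L2.inner_def]
    refine integral_congr_ae ?_
    filter_upwards [(h.memLp_grad_ofReal i).coeFn_toLp, (h'.memLp_grad_ofReal j).coeFn_toLp]
      with x h1 h2
    rw [h1, h2, RCLike.inner_apply]
    simp [mul_comm]
  -- By Parseval both sides become the same series: the factor `4π² k₀ k₁` is symmetric in the two
  -- indices.
  have key2 : (∫ x in cell, G x 0 * H x 1 : ℝ) = ((∫ x in cell, G x 1 * H x 0 : ℝ) : ℂ) := by
    rw [key, key, ← fourierBasis.tsum_inner_mul_inner, ← fourierBasis.tsum_inner_mul_inner]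
    refine tsum_congr fun k => ?_
    simp only [← inner_conj_symm _ (fourierBasis k), ← fourierBasis.repr_apply_apply,
      fourierBasis_repr_toLp, h.fourierCoef_grad, h'.fourierCoef_grad]
    simp only [map_mul, Complex.conj_I, map_intCast, Complex.conj_ofReal]
    ring
  exact_mod_cast key2

theorem real_inner_eq (f g : FieldSpace) :
    inner ℝ f g = ∫ x in cell, inner ℝ (f x) (g x) := rfl

/-- The pointwise inner product is, up to sign, a Jacobian determinant. This orthogonality expresses
that a rotated gradient is divergence free. -/
theorem inner_gradSpace_I_smul {v w : FieldSpace} (hv : v ∈ gradSpace) (hw : w ∈ gradSpace) :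
    inner ℝ v (Complex.I • w) = 0 := by
  obtain ⟨u, G, h, hG⟩ := hv
  obtain ⟨u', H, h', hH⟩ := hw
  have e : inner ℝ v (Complex.I • w) = ∫ x in cell, (G x 1 * H x 0 - G x 0 * H x 1) := by
    rw [real_inner_eq]
    refine integral_congr_ae ?_
    filter_upwards [Lp.coeFn_smul Complex.I w, hG, hH] with x h1 h2 h3
    rw [h1, Pi.smul_apply, h2, h3]
    simp [Complex.inner, toC]
    ring
  have hi : ∀ i j, Integrable (fun x => G x i * H x j) cellMeasure := fun i j =>
    (h.memL2Loc_grad i).memLp_cell.integrable_mul (h'.memL2Loc_grad j).memLp_cell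
  rw [e, integral_sub (hi 1 0) (hi 0 1), h.integral_grad_mul_grad h', sub_self]

/-- Constant fields. -/
def constField : ℂ →L[ℝ] FieldSpace := Lp.constL 2 cellMeasure ℝ

theorem coeFn_constField (c : ℂ) : constField c =ᵐ[cellMeasure] fun _ => c :=
  Lp.coeFn_const 2 cellMeasure c

theorem inner_constField (c : ℂ) (f : FieldSpace) :
    inner ℝ (constField c) f = inner ℝ c (∫ x in cell, f x) := by
  rw [← integral_inner ((Lp.memLp f).integrable (by norm_num)), real_inner_eq]
  refine integral_congr_ae ?_
  filter_upwards [coeFn_constField c] with x hx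
  rw [hx]

theorem integral_gradSpace {v : FieldSpace} (hv : v ∈ gradSpace) : ∫ x in cell, v x = 0 := by
  obtain ⟨u, G, h, hG⟩ := hv
  have h0 := h.integral_grad 0
  have h1 := h.integral_grad 1
  rw [integral_congr_ae hG]
  simp only [toC_eq]
  rw [integral_add ((h.memLp_grad_ofReal 0).integrable (by norm_num))
      (((h.memLp_grad_ofReal 1).integrable (by norm_num)).const_mul _), integral_const_mul,
    integral_complex_ofReal, integral_complex_ofReal, h0, h1]
  simp

theorem inner_constField_gradSpace (c : ℂ) {v : FieldSpace} (hv : v ∈ gradSpace) :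
    inner ℝ (constField c) v = 0 := by
  rw [inner_constField, integral_gradSpace hv, inner_zero_right]

/-- Riesz–Fischer by domination; it realizes Fourier multipliers of modulus at most 1. -/
theorem exists_repr_eq_of_norm_le (g : FieldSpace) (c : (Fin 2 → ℤ) → ℂ)
    (h : ∀ k, ‖c k‖ ≤ ‖fourierBasis.repr g k‖) :
    ∃ f : FieldSpace, ∀ k, fourierBasis.repr f k = c k := by
  have hc : Memℓp c 2 := by
    refine memℓp_gen ?_
    refine Summable.of_nonneg_of_le (fun k => by positivity) (fun k => ?_)
      ((lp.memℓp (fourierBasis.repr g)).summable (by norm_num))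
    exact Real.rpow_le_rpow (norm_nonneg _) (h k) (by norm_num)
  exact ⟨fourierBasis.repr.symm ⟨c, hc⟩, fun k => by simp⟩

theorem isPeriodicH1_im {u : FieldSpace} {v : Fin 2 → FieldSpace}
    (h : ∀ i k, fourierBasis.repr (v i) k
      = 2 * Real.pi * Complex.I * k i * fourierBasis.repr u k) :
    ∃ U G, IsPeriodicH1 U G ∧
      ∀ i, (fun x => G x i) =ᵐ[cellMeasure] fun x => (v i x).im := by
  have h' : ∀ i k, fourierBasis.repr ((-Complex.I) • v i) k
      = 2 * Real.pi * Complex.I * k i * fourierBasis.repr ((-Complex.I) • u) k := by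
    intro i k
    simp only [map_smul, lp.coeFn_smul, Pi.smul_apply, smul_eq_mul, h]
    ring
  refine ⟨_, _, isPeriodicH1_re h', fun i => ?_⟩
  filter_upwards [Lp.coeFn_smul (-Complex.I) (v i), ae_restrict_mem measurableSet_cell]
    with x hx hxc
  rw [fractPart_of_mem_cell hxc, hx]
  simp

/-- Hodge decomposition of a mean zero field on the cell. -/
theorem exists_gradSpace_add_I_smul (g : FieldSpace) (hg : ∫ x in cell, g x = 0) :
    ∃ v ∈ gradSpace, ∃ w ∈ gradSpace, g = v + Complex.I • w := by
  have hg0 : fourierBasis.repr g 0 = 0 := by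
    rw [fourierBasis_repr, ← hg]
    refine integral_congr_ae (Eventually.of_forall fun x => ?_)
    simp [planeWave]
  -- Division of the coefficients of `g` by `2πi (k₀ + i k₁)` solves `∂₀u + i ∂₁u = g` for a complex
  -- potential `u`. The real and imaginary parts of `u` are then the potentials of `v` and `w`.
  set z : (Fin 2 → ℤ) → ℂ := fun k => (k 0 : ℂ) + Complex.I * (k 1 : ℂ) with hzdef
  have hzn : ∀ k, ‖z k‖ ^ 2 = (k 0 : ℝ) ^ 2 + (k 1 : ℝ) ^ 2 := by
    intro k
    rw [← Complex.normSq_eq_norm_sq, Complex.normSq_apply]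
    simp [hzdef]
    ring
  have hz : ∀ k, k ≠ 0 → z k ≠ 0 := by
    intro k hk h0
    have h1 := hzn k
    rw [h0, norm_zero] at h1
    apply hk
    have h2 : (k 0 : ℝ) = 0 := by nlinarith [sq_nonneg (k 0 : ℝ), sq_nonneg (k 1 : ℝ)]
    have h3 : (k 1 : ℝ) = 0 := by nlinarith [sq_nonneg (k 0 : ℝ), sq_nonneg (k 1 : ℝ)]
    funext i
    fin_cases i
    · exact_mod_cast h2
    · exact_mod_cast h3
  have hkz : ∀ i k, ‖((k i : ℤ) : ℂ)‖ ≤ ‖z k‖ := by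
    intro i k
    refine abs_le_of_sq_le_sq' ?_ (norm_nonneg _) |>.2
    rw [hzn, Complex.norm_intCast, sq_abs]
    fin_cases i
    · exact le_add_of_nonneg_right (sq_nonneg _)
    · exact le_add_of_nonneg_left (sq_nonneg _)
  have hz1 : ∀ k, k ≠ 0 → 1 ≤ ‖z k‖ := by
    intro k hk
    obtain ⟨i, hi⟩ := Function.ne_iff.1 hk
    refine le_trans ?_ (hkz i k)
    rw [Complex.norm_intCast]
    exact_mod_cast Int.one_le_abs hi
  set p : ℂ := 2 * Real.pi * Complex.I with hp
  have hpn : 1 ≤ ‖p‖ := by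
    have : ‖p‖ = 2 * Real.pi := by simp [hp, abs_of_pos Real.pi_pos]
    rw [this]
    linarith [Real.pi_gt_three]
  have hp0 : p ≠ 0 := norm_pos_iff.1 (by linarith)
  obtain ⟨u, hu⟩ := exists_repr_eq_of_norm_le g (fun k => fourierBasis.repr g k / (p * z k)) (by
    intro k
    rcases eq_or_ne k 0 with rfl | hk
    · simp [hg0]
    · rw [norm_div, norm_mul]
      refine div_le_self (norm_nonneg _) ?_
      exact one_le_mul_of_one_le_of_one_le hpn (hz1 k hk))
  have hv : ∀ i, ∃ v : FieldSpace, ∀ k, fourierBasis.repr v k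
      = 2 * Real.pi * Complex.I * k i * fourierBasis.repr u k := by
    intro i
    refine exists_repr_eq_of_norm_le g _ fun k => ?_
    rcases eq_or_ne k 0 with rfl | hk
    · simp
    · have hzk := hz k hk
      rw [hu]
      have : 2 * Real.pi * Complex.I * k i * (fourierBasis.repr g k / (p * z k))
          = (k i / z k) * fourierBasis.repr g k := by
        rw [← hp]; field_simp
      rw [this, norm_mul, norm_div]
      refine mul_le_of_le_one_left (norm_nonneg _) ?_
      exact div_le_one_of_le₀ (hkz i k) (norm_nonneg _)
  choose v hv using hv
  have hsum : g = v 0 + Complex.I • v 1 := by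
    apply fourierBasis.repr.injective
    ext k
    simp only [map_add, map_smul, lp.coeFn_add, lp.coeFn_smul, Pi.add_apply, Pi.smul_apply,
      smul_eq_mul, hv]
    rcases eq_or_ne k 0 with rfl | hk
    · simp [hg0]
    · have hzk := hz k hk
      rw [hu, ← hp]
      have : p * k 0 * (fourierBasis.repr g k / (p * z k))
        + Complex.I * (p * k 1 * (fourierBasis.repr g k / (p * z k)))
        = z k * (fourierBasis.repr g k / z k) := by
        simp only [hzdef] at hzk ⊢
        field_simp
      rw [this]
      field_simp
  have hre := isPeriodicH1_re hv
  obtain ⟨U, G, him, hG⟩ := isPeriodicH1_im hv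
  refine ⟨_, hre.toLp_mem_gradSpace, _, him.toLp_mem_gradSpace, ?_⟩
  refine Lp.ext ?_
  rw [hsum]
  filter_upwards [Lp.coeFn_add (v 0) (Complex.I • v 1), Lp.coeFn_smul Complex.I (v 1),
    Lp.coeFn_add (hre.memLp_toC.toLp _) (Complex.I • him.memLp_toC.toLp _),
    Lp.coeFn_smul Complex.I (him.memLp_toC.toLp _), hre.memLp_toC.coeFn_toLp,
    him.memLp_toC.coeFn_toLp, hG 0, hG 1, ae_restrict_mem measurableSet_cell]
    with x h1 h2 h3 h4 h5 h6 h7 h8 hxc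
  rw [h1, h3, Pi.add_apply, Pi.add_apply, h2, h4, Pi.smul_apply, Pi.smul_apply, h5, h6]
  simp only [fractPart_of_mem_cell hxc]
  apply Complex.ext <;> simp [toC, h7, h8]
  ring

theorem integral_constField (c : ℂ) : ∫ x in cell, constField c x = c := by
  rw [integral_congr_ae (coeFn_constField c)]
  simp

/-- A field orthogonal to the gradients is divergence free, hence a constant plus a rotated
gradient. -/
theorem exists_eq_constField_add_I_smul {f : FieldSpace} (hf : ∀ v ∈ gradSpace, inner ℝ f v = 0) :
    ∃ w ∈ gradSpace, f = constField (∫ x in cell, f x) + Complex.I • w := by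
  have h0 : ∫ x in cell, (f - constField (∫ x in cell, f x)) x = 0 := by
    rw [integral_congr_ae (Lp.coeFn_sub _ _)]
    simp only [Pi.sub_apply]
    rw [integral_sub ((Lp.memLp f).integrable (by norm_num))
      ((Lp.memLp _).integrable (by norm_num)), integral_constField, sub_self]
  obtain ⟨v, hv, w, hw, e⟩ := exists_gradSpace_add_I_smul _ h0
  -- The gradient part is orthogonal to the whole field and to the rotated part, hence to itself.
  have hv0 : v = 0 := by
    have h1 : inner ℝ (f - constField (∫ x in cell, f x)) v = 0 := by
      rw [inner_sub_left, hf v hv, inner_constField_gradSpace _ hv, sub_zero]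
    rw [e, inner_add_left, real_inner_comm v (Complex.I • w), inner_gradSpace_I_smul hv hw,
      add_zero] at h1
    exact inner_self_eq_zero.1 h1
  refine ⟨w, hw, ?_⟩
  rw [hv0, zero_add] at e
  rw [← e]
  abel

/-- By the Hodge decomposition, gradients are exactly the fields orthogonal to the constants and to
the rotated gradients; no Poincaré inequality is needed. -/
theorem isClosed_gradSpace : IsClosed (gradSpace : Set FieldSpace) := by
  have : (gradSpace : Set FieldSpace) =
      (⋂ w ∈ gradSpace, {g : FieldSpace | inner ℝ g (Complex.I • w) = 0})
        ∩ ⋂ c : ℂ, {g : FieldSpace | inner ℝ g (constField c) = 0} := by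
    ext g
    simp only [SetLike.mem_coe, mem_inter_iff, mem_iInter, mem_ofPred_eq]
    refine ⟨fun hg => ⟨fun w hw => inner_gradSpace_I_smul hg hw, fun c => by
      rw [real_inner_comm]; exact inner_constField_gradSpace c hg⟩, fun ⟨h1, h2⟩ => ?_⟩
    have hm : ∫ x in cell, g x = 0 := by
      have := h2 (∫ x in cell, g x)
      rw [real_inner_comm, inner_constField] at this
      exact inner_self_eq_zero.1 this
    obtain ⟨v, hv, w, hw, e⟩ := exists_gradSpace_add_I_smul g hm
    have h3 := h1 w hw
    rw [e, inner_add_left, inner_gradSpace_I_smul hv hw, zero_add] at h3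
    rw [e, inner_self_eq_zero.1 h3, add_zero]
    exact hv
  rw [this]
  refine IsClosed.inter (isClosed_biInter fun w _ => ?_) (isClosed_iInter fun c => ?_)
  · exact isClosed_eq (continuous_id.inner continuous_const) continuous_const
  · exact isClosed_eq (continuous_id.inner continuous_const) continuous_const

instance : CompleteSpace gradSpace := isClosed_gradSpace.completeSpace_coe

/-! ### Multiplication operators and the cell problem -/

theorem memLp_mul_coeFn {s : Plane → ℂ} (hs : Measurable s) {C : ℝ} (hC : ∀ x, ‖s x‖ ≤ C)
    (f : FieldSpace) : MemLp (fun x => s x * f x) 2 cellMeasure :=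
  (Lp.memLp f).of_le_mul (c := C)
    (hs.aestronglyMeasurable.mul (Lp.aestronglyMeasurable f))
    (Eventually.of_forall fun x => by
      rw [norm_mul]; exact mul_le_mul_of_nonneg_right (hC x) (norm_nonneg _))

/-- Multiplication by a bounded function. -/
def mulOp {s : Plane → ℂ} (hs : Measurable s) {C : ℝ} (hC : ∀ x, ‖s x‖ ≤ C) :
    FieldSpace →L[ℝ] FieldSpace :=
  LinearMap.mkContinuous
    { toFun := fun f => (memLp_mul_coeFn hs hC f).toLp _
      map_add' := fun f g => by
        refine Lp.ext ?_
        filter_upwards [(memLp_mul_coeFn hs hC (f + g)).coeFn_toLp,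
          (memLp_mul_coeFn hs hC f).coeFn_toLp, (memLp_mul_coeFn hs hC g).coeFn_toLp,
          Lp.coeFn_add f g, Lp.coeFn_add ((memLp_mul_coeFn hs hC f).toLp _)
            ((memLp_mul_coeFn hs hC g).toLp _)] with x h1 h2 h3 h4 h5
        rw [h1, h5, Pi.add_apply, h2, h3, h4, Pi.add_apply, mul_add]
      map_smul' := fun r f => by
        refine Lp.ext ?_
        filter_upwards [(memLp_mul_coeFn hs hC (r • f)).coeFn_toLp,
          (memLp_mul_coeFn hs hC f).coeFn_toLp, Lp.coeFn_smul r f,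
          Lp.coeFn_smul r ((memLp_mul_coeFn hs hC f).toLp _)] with x h1 h2 h3 h4
        rw [RingHom.id_apply, h1, h4, Pi.smul_apply, h2, h3, Pi.smul_apply, mul_smul_comm] }
    C fun f => by
      refine Lp.norm_le_mul_norm_of_ae_le_mul ?_
      filter_upwards [(memLp_mul_coeFn hs hC f).coeFn_toLp] with x hx
      simp only [LinearMap.coe_mk, AddHom.coe_mk]
      rw [hx, norm_mul]
      exact mul_le_mul_of_nonneg_right (hC x) (norm_nonneg _)

theorem coeFn_mulOp {s : Plane → ℂ} (hs : Measurable s) {C : ℝ} (hC : ∀ x, ‖s x‖ ≤ C)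
    (f : FieldSpace) : mulOp hs hC f =ᵐ[cellMeasure] fun x => s x * f x :=
  (memLp_mul_coeFn hs hC f).coeFn_toLp

/-- A bounded operator whose quadratic form is bounded below. -/
def CoerciveOp (S : FieldSpace →L[ℝ] FieldSpace) : Prop :=
  ∃ α : ℝ, 0 < α ∧ ∀ f, α * (‖f‖ * ‖f‖) ≤ inner ℝ (S f) f

/-- The imaginary part of the coefficient acts as a rotation and drops out of the quadratic form, so
only the real part matters. -/
theorem coerciveOp_mulOp {s : Plane → ℂ} (hs : Measurable s) {C : ℝ} (hC : ∀ x, ‖s x‖ ≤ C)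
    {α : ℝ} (hα : 0 < α) (h : ∀ x, α ≤ (s x).re) : CoerciveOp (mulOp hs hC) := by
  refine ⟨α, hα, fun f => ?_⟩
  rw [← real_inner_self_eq_norm_mul_norm, real_inner_eq, real_inner_eq, ← integral_const_mul]
  refine integral_mono_ae ((L2.integrable_inner f f).const_mul α)
    (L2.integrable_inner (mulOp hs hC f) f) ?_
  filter_upwards [coeFn_mulOp hs hC f] with x hx
  rw [hx]
  have h1 : inner ℝ (s x * f x) (f x) = (s x).re * inner ℝ (f x) (f x) := by
    simp only [Complex.inner, map_mul, Complex.mul_re, Complex.mul_im, Complex.conj_re,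
      Complex.conj_im]
    ring
  rw [h1]
  exact mul_le_mul_of_nonneg_right (h x) real_inner_self_nonneg

/-- The solution operator of the cell problem. -/
theorem CoerciveOp.exists_corrector {S : FieldSpace →L[ℝ] FieldSpace} (hS : CoerciveOp S) :
    ∃ c : ℂ →ₗ[ℝ] FieldSpace, (∀ l, c l - constField l ∈ gradSpace) ∧
      ∀ l, ∀ φ ∈ gradSpace, inner ℝ (S (c l)) φ = 0 := by
  set I : FieldSpace →L[ℝ] FieldSpace →L[ℝ] ℝ :=
    (isBoundedBilinearMap_inner (𝕜 := ℝ) (E := FieldSpace)).toContinuousLinearMap with hI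
  have hIapp : ∀ f g, I f g = inner ℝ f g := fun f g => rfl
  set B : gradSpace →L[ℝ] gradSpace →L[ℝ] ℝ :=
    I.bilinearComp (S ∘L gradSpace.subtypeL) gradSpace.subtypeL with hB
  have hBapp : ∀ v w : gradSpace, B v w = inner ℝ (S v) (w : FieldSpace) := fun v w => rfl
  have hco : IsCoercive B := by
    obtain ⟨α, hα, h⟩ := hS
    refine ⟨α, hα, fun v => ?_⟩
    rw [hBapp, mul_assoc]
    exact h v
  set E := hco.continuousLinearEquivOfBilin
  -- Lax–Milgram: the gradient correction solves the projected equation with right-hand side minus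
  -- the flux of the constant field, linearly in `l`.
  set sol : ℂ →ₗ[ℝ] gradSpace := -((E.symm : gradSpace →L[ℝ] gradSpace)
    ∘L gradSpace.orthogonalProjectionOnto ∘L S ∘L constField).toLinearMap with hsol
  refine ⟨constField.toLinearMap + gradSpace.subtype ∘ₗ sol, fun l => ?_, fun l φ hφ => ?_⟩
  · simp
  · have h1 : inner ℝ (S (sol l)) φ = -inner ℝ (S (constField l)) φ := by
      have h2 := hBapp (sol l) ⟨φ, hφ⟩
      rw [← hco.continuousLinearEquivOfBilin_apply] at h2
      rw [← h2]
      simp only [hsol, LinearMap.neg_apply, map_neg, ContinuousLinearMap.coe_coe,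
        ContinuousLinearMap.comp_apply, ContinuousLinearEquiv.coe_coe, inner_neg_left]
      rw [ContinuousLinearEquiv.apply_symm_apply,
        Submodule.inner_orthogonalProjectionOnto_eq_of_mem_right]
    simp only [LinearMap.add_apply, LinearMap.comp_apply, ContinuousLinearMap.coe_coe,
      Submodule.subtype_apply, map_add, inner_add_left, h1]
    ring

theorem CoerciveOp.corrector_unique {S : FieldSpace →L[ℝ] FieldSpace} (hS : CoerciveOp S)
    {f g : FieldSpace} (hfg : f - g ∈ gradSpace) (hf : ∀ φ ∈ gradSpace, inner ℝ (S f) φ = 0)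
    (hg : ∀ φ ∈ gradSpace, inner ℝ (S g) φ = 0) : f = g := by
  obtain ⟨α, hα, h⟩ := hS
  have h1 := h (f - g)
  rw [map_sub, inner_sub_left, hf _ hfg, hg _ hfg, sub_zero] at h1
  have h2 : ‖f - g‖ = 0 := by
    by_contra hne
    have : 0 < ‖f - g‖ := lt_of_le_of_ne (norm_nonneg _) (Ne.symm hne)
    have : 0 < α * (‖f - g‖ * ‖f - g‖) := by positivity
    linarith
  exact sub_eq_zero.1 (norm_eq_zero.1 h2)

/-! ### Mean fields and mean fluxes -/

theorem inner_I_smul_constField {w : FieldSpace} (hw : w ∈ gradSpace) (l : ℂ) :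
    inner ℝ (Complex.I • w) (constField l) = 0 := by
  have h : ∫ x in cell, (Complex.I • w) x = 0 := by
    rw [integral_congr_ae (Lp.coeFn_smul Complex.I w)]
    simp only [Pi.smul_apply]
    rw [integral_smul, integral_gradSpace hw, smul_zero]
  rw [real_inner_comm, inner_constField, h, inner_zero_right]

theorem inner_constField_constField (m l : ℂ) :
    inner ℝ (constField m) (constField l) = inner ℝ m l := by
  rw [inner_constField, integral_constField]

/-- Div-curl identity: all cross terms vanish by orthogonality, so the mean of the product is the
product of the means. -/
theorem inner_flux_grad {v w : FieldSpace} (hv : v ∈ gradSpace) (hw : w ∈ gradSpace) (m l : ℂ) :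
    inner ℝ (constField m + Complex.I • w) (constField l + v) = inner ℝ m l := by
  rw [inner_add_left, inner_add_right, inner_add_right, inner_constField_constField,
    inner_constField_gradSpace m hv, inner_I_smul_constField hw,
    real_inner_comm v (Complex.I • w), inner_gradSpace_I_smul hv hw]
  ring

theorem inner_flux_gradSpace {v w : FieldSpace} (hv : v ∈ gradSpace) (hw : w ∈ gradSpace) (m : ℂ) :
    inner ℝ (constField m + Complex.I • w) v = 0 := by
  simpa using inner_flux_grad hv hw m 0

/-- The pair of mean field `l` and mean flux `m` is realized by a gradient field with divergence-free
flux. -/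
def IsMeanPair (S : FieldSpace →L[ℝ] FieldSpace) (l m : ℂ) : Prop :=
  ∃ v ∈ gradSpace, ∃ w ∈ gradSpace, S (constField l + v) = constField m + Complex.I • w

/-- Coercivity determines the field from its mean, and pairing the flux with constants recovers `m`.
This identifies an effective matrix from any field realizing the means. -/
theorem CoerciveOp.isMeanPair_unique {S : FieldSpace →L[ℝ] FieldSpace} (hS : CoerciveOp S)
    {l m m' : ℂ} (h : IsMeanPair S l m) (h' : IsMeanPair S l m') : m = m' := by
  obtain ⟨v, hv, w, hw, e⟩ := h
  obtain ⟨v', hv', w', hw', e'⟩ := h'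
  have h1 : constField l + v = constField l + v' := by
    refine hS.corrector_unique ?_ (fun φ hφ => ?_) (fun φ hφ => ?_)
    · rw [add_sub_add_left_eq_sub]; exact gradSpace.sub_mem hv hv'
    · rw [e]; exact inner_flux_gradSpace hφ hw m
    · rw [e']; exact inner_flux_gradSpace hφ hw' m'
  rw [h1, e'] at e
  have h2 : ∀ c : ℂ, inner ℝ m c = inner ℝ m' c := fun c => by
    rw [← inner_flux_grad (Submodule.zero_mem _) hw m c, ← e,
      inner_flux_grad (Submodule.zero_mem _) hw' m' c]
  exact ext_inner_right ℝ h2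

/-! ### Effective matrices in complex notation -/

theorem toC_injective : Function.Injective toC := by
  intro x y h
  funext i
  fin_cases i
  · exact congrArg Complex.re h
  · exact congrArg Complex.im h

/-- The inverse of `toC`. -/
def ofC (z : ℂ) : Plane := ![z.re, z.im]

theorem toC_ofC (z : ℂ) : toC (ofC z) = z := rfl

/-- The matrix `A` acts as multiplication by the complex number `z`. -/
def ActsAs (A : Matrix (Fin 2) (Fin 2) ℝ) (z : ℂ) : Prop := ∀ x, toC (A *ᵥ x) = z * toC x

theorem actsAs_phase (α β h : ℝ) : ActsAs (phase α β h) ⟨α, h * β⟩ := by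
  intro x
  apply Complex.ext <;>
    simp [phase, rotJ, toC, mulVec, dotProduct, Fin.sum_univ_two] <;> ring

theorem actsAs_smul_one (γ : ℝ) : ActsAs (γ • (1 : Matrix (Fin 2) (Fin 2) ℝ)) γ := by
  intro x
  rw [smul_mulVec, one_mulVec, toC_smul, Complex.real_smul]

theorem actsAs_rotJ : ActsAs rotJ Complex.I := by
  intro x
  apply Complex.ext <;> simp [rotJ, toC, mulVec, dotProduct, Fin.sum_univ_two]

/-- The two-phase coefficient with values `z₁` outside and `z₂` inside of `ω`. -/
def phaseFun (ω : Set Plane) (z₁ z₂ : ℂ) (x : Plane) : ℂ :=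
  z₁ + ω.indicator (fun _ => z₂ - z₁) x

theorem phaseFun_of_mem {ω : Set Plane} {x : Plane} (h : x ∈ ω) (z₁ z₂ : ℂ) :
    phaseFun ω z₁ z₂ x = z₂ := by simp [phaseFun, h]

theorem phaseFun_of_notMem {ω : Set Plane} {x : Plane} (h : x ∉ ω) (z₁ z₂ : ℂ) :
    phaseFun ω z₁ z₂ x = z₁ := by simp [phaseFun, h]

theorem measurable_phaseFun {ω : Set Plane} (hω : MeasurableSet ω) (z₁ z₂ : ℂ) :
    Measurable (phaseFun ω z₁ z₂) := measurable_const.add (measurable_const.indicator hω)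

theorem norm_phaseFun_le (ω : Set Plane) (z₁ z₂ : ℂ) (x : Plane) :
    ‖phaseFun ω z₁ z₂ x‖ ≤ max ‖z₁‖ ‖z₂‖ := by
  by_cases h : x ∈ ω
  · rw [phaseFun_of_mem h]; exact le_max_right _ _
  · rw [phaseFun_of_notMem h]; exact le_max_left _ _

/-- Multiplication by the two-phase coefficient. -/
def phaseOp {ω : Set Plane} (hω : MeasurableSet ω) (z₁ z₂ : ℂ) : FieldSpace →L[ℝ] FieldSpace :=
  mulOp (measurable_phaseFun hω z₁ z₂) (norm_phaseFun_le ω z₁ z₂)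

theorem coeFn_phaseOp {ω : Set Plane} (hω : MeasurableSet ω) (z₁ z₂ : ℂ) (f : FieldSpace) :
    phaseOp hω z₁ z₂ f =ᵐ[cellMeasure] fun x => phaseFun ω z₁ z₂ x * f x := coeFn_mulOp _ _ f

theorem coerciveOp_phaseOp {ω : Set Plane} (hω : MeasurableSet ω) {z₁ z₂ : ℂ} (h₁ : 0 < z₁.re)
    (h₂ : 0 < z₂.re) : CoerciveOp (phaseOp hω z₁ z₂) := by
  refine coerciveOp_mulOp _ _ (lt_min h₁ h₂) fun x => ?_
  by_cases h : x ∈ ω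
  · rw [phaseFun_of_mem h]; exact min_le_right _ _
  · rw [phaseFun_of_notMem h]; exact min_le_left _ _

theorem toC_twoPhase_mulVec {A₁ A₂ : Matrix (Fin 2) (Fin 2) ℝ} {z₁ z₂ : ℂ} (h₁ : ActsAs A₁ z₁)
    (h₂ : ActsAs A₂ z₂) (ω : Set Plane) {y : Plane} (hy : y ∈ cell) (x : Plane) :
    toC (twoPhase ω A₁ A₂ y *ᵥ x) = phaseFun ω z₁ z₂ y * toC x := by
  rw [twoPhase, fractPart_of_mem_cell hy]
  by_cases h : y ∈ ω
  · rw [indicator_of_mem h, phaseFun_of_mem h, sub_self, zero_smul, zero_add, one_smul, h₂ x]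
  · rw [indicator_of_notMem h, phaseFun_of_notMem h, sub_zero, zero_smul, add_zero, one_smul, h₁ x]

theorem integral_twoPhase_mulVec_dotProduct {ω : Set Plane} (hω : MeasurableSet ω)
    {A₁ A₂ : Matrix (Fin 2) (Fin 2) ℝ} {z₁ z₂ : ℂ} (h₁ : ActsAs A₁ z₁) (h₂ : ActsAs A₂ z₂)
    {f g : FieldSpace} {F G : Plane → Plane}
    (hf : f =ᵐ[cellMeasure] fun x => toC (F x)) (hg : g =ᵐ[cellMeasure] fun x => toC (G x)) :
    ∫ y in cell, (twoPhase ω A₁ A₂ y *ᵥ F y) ⬝ᵥ G y = inner ℝ (phaseOp hω z₁ z₂ f) g := by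
  rw [real_inner_eq]
  refine integral_congr_ae ?_
  filter_upwards [hf, hg, coeFn_phaseOp hω z₁ z₂ f, ae_restrict_mem measurableSet_cell]
    with x h1 h2 h3 hx
  rw [h3, h1, h2, ← toC_twoPhase_mulVec h₁ h₂ ω hx, inner_toC]

theorem IsCorrector.exists_field {ω : Set Plane} (hω : MeasurableSet ω)
    {A₁ A₂ : Matrix (Fin 2) (Fin 2) ℝ} {z₁ z₂ : ℂ} (h₁ : ActsAs A₁ z₁) (h₂ : ActsAs A₂ z₂)
    {l : Plane} {W : Plane → ℝ} {G : Plane → Plane}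
    (h : IsCorrector (twoPhase ω A₁ A₂) l W G) :
    ∃ v ∈ gradSpace, (∀ φ ∈ gradSpace,
        inner ℝ (phaseOp hω z₁ z₂ (constField (toC l) + v)) φ = 0) ∧
      (constField (toC l) + v : FieldSpace) =ᵐ[cellMeasure] fun x => toC (G x) := by
  set v := h.periodicH1.memLp_toC.toLp _ with hv
  have hG : (constField (toC l) + v : FieldSpace) =ᵐ[cellMeasure] fun x => toC (G x) := by
    filter_upwards [Lp.coeFn_add (constField (toC l)) v, coeFn_constField (toC l),
      h.periodicH1.memLp_toC.coeFn_toLp] with x e1 e2 e3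
    rw [e1, Pi.add_apply, e2, hv, e3, ← toC_add, add_sub_cancel]
  refine ⟨v, h.periodicH1.toLp_mem_gradSpace, fun φ hφ => ?_, hG⟩
  obtain ⟨u, Φ, hΦ, e⟩ := hφ
  rw [← integral_twoPhase_mulVec_dotProduct hω h₁ h₂ hG e]
  exact h.equation u Φ hΦ

theorem exists_isCorrector {ω : Set Plane} (hω : MeasurableSet ω)
    {A₁ A₂ : Matrix (Fin 2) (Fin 2) ℝ} {z₁ z₂ : ℂ} (h₁ : ActsAs A₁ z₁) (h₂ : ActsAs A₂ z₂)
    {l : Plane} {v : FieldSpace} (hv : v ∈ gradSpace)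
    (h : ∀ φ ∈ gradSpace, inner ℝ (phaseOp hω z₁ z₂ (constField (toC l) + v)) φ = 0) :
    ∃ W G, IsCorrector (twoPhase ω A₁ A₂) l W G ∧
      (constField (toC l) + v : FieldSpace) =ᵐ[cellMeasure] fun x => toC (G x) := by
  obtain ⟨u, G, hu, hG⟩ := hv
  have hG' : (constField (toC l) + v : FieldSpace) =ᵐ[cellMeasure] fun x => toC (G x + l) := by
    filter_upwards [Lp.coeFn_add (constField (toC l)) v, coeFn_constField (toC l), hG]
      with x e1 e2 e3
    rw [e1, Pi.add_apply, e2, e3, ← toC_add, add_comm]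
  -- The potential is free up to a constant; subtracting its mean meets the normalization, as the
  -- cell has measure 1.
  set c := ∫ y in cell, u y with hc
  refine ⟨fun y => (u y - c) + l ⬝ᵥ y, fun y => G y + l, ⟨?_, ?_, ?_⟩, hG'⟩
  · simpa using hu.sub_const c
  · simp only [add_sub_cancel_right]
    rw [integral_sub (hu.memL2Loc.memLp_cell.integrable (by norm_num)) (integrable_const c)]
    simp [hc]
  · intro φ Φ hΦ
    rw [integral_twoPhase_mulVec_dotProduct hω h₁ h₂ hG' hΦ.memLp_toC.coeFn_toLp]
    exact h _ hΦ.toLp_mem_gradSpace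

/-- By the div-curl identity the energy `A l · m` equals the mean flux dotted with `m`, so `A l` is
the mean flux, without any symmetry of the coefficient. -/
theorem IsEffectiveMatrix.isMeanPair {ω : Set Plane} (hω : MeasurableSet ω)
    {A₁ A₂ : Matrix (Fin 2) (Fin 2) ℝ} {z₁ z₂ : ℂ} (h₁ : ActsAs A₁ z₁) (h₂ : ActsAs A₂ z₂)
    {A : Matrix (Fin 2) (Fin 2) ℝ}
    (h : IsEffectiveMatrix (twoPhase ω A₁ A₂) A) (l : Plane) :
    IsMeanPair (phaseOp hω z₁ z₂) (toC l) (toC (A *ᵥ l)) := by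
  obtain ⟨W, G, hcor, hA⟩ := h
  have hf := fun l => (hcor l).exists_field hω h₁ h₂
  choose v hv horth hG using hf
  obtain ⟨m, w, hw, e⟩ : ∃ m, ∃ w ∈ gradSpace,
      phaseOp hω z₁ z₂ (constField (toC l) + v l) = constField m + Complex.I • w :=
    ⟨_, exists_eq_constField_add_I_smul (horth l)⟩
  refine ⟨v l, hv l, w, hw, ?_⟩
  suffices hm : toC (A *ᵥ l) = m by rw [e, hm]
  refine ext_inner_right ℝ fun c => ?_
  rw [← toC_ofC c, inner_toC, hA,
    integral_twoPhase_mulVec_dotProduct hω h₁ h₂ (hG l) (hG (ofC c)), e,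
    inner_flux_grad (hv _) hw]

theorem exists_isEffectiveMatrix {ω : Set Plane} (hω : MeasurableSet ω)
    {A₁ A₂ : Matrix (Fin 2) (Fin 2) ℝ} {z₁ z₂ : ℂ} (h₁ : ActsAs A₁ z₁) (h₂ : ActsAs A₂ z₂)
    (hz₁ : 0 < z₁.re) (hz₂ : 0 < z₂.re) :
    ∃ A, IsEffectiveMatrix (twoPhase ω A₁ A₂) A := by
  obtain ⟨c, hc, horth⟩ := (coerciveOp_phaseOp hω hz₁ hz₂).exists_corrector
  have hex := fun l : Plane => exists_isCorrector hω h₁ h₂ (hc (toC l))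
    (by rw [add_sub_cancel]; exact horth (toC l))
  simp only [add_sub_cancel] at hex
  choose W G hcor hG using hex
  -- The candidate matrix sends `l` to the mean flux of its corrector field.
  set T : Plane →ₗ[ℝ] Plane :=
    { toFun := fun l => ofC (∫ x in cell, phaseOp hω z₁ z₂ (c (toC l)) x)
      map_add' := fun l m => by
        apply toC_injective
        rw [toC_ofC, toC_add l m, toC_add, toC_ofC, toC_ofC, map_add, map_add,
          integral_congr_ae (Lp.coeFn_add _ _)]
        exact integral_add ((Lp.memLp _).integrable (by norm_num))
          ((Lp.memLp _).integrable (by norm_num))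
      map_smul' := fun r l => by
        apply toC_injective
        rw [RingHom.id_apply, toC_ofC, toC_smul r l, toC_smul, toC_ofC, map_smul, map_smul,
          integral_congr_ae (Lp.coeFn_smul _ _)]
        exact integral_smul r (fun x => phaseOp hω z₁ z₂ (c (toC l)) x) } with hT
  refine ⟨LinearMap.toMatrix' T, W, G, hcor, fun l m => ?_⟩
  obtain ⟨w, hw, e⟩ := exists_eq_constField_add_I_smul (horth (toC l))
  rw [integral_twoPhase_mulVec_dotProduct hω h₁ h₂ (hG l) (hG m), e,
    ← add_sub_cancel (constField (toC m)) (c (toC m)), inner_flux_grad (hc _) hw,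
    LinearMap.toMatrix'_mulVec, ← inner_toC]
  rfl

theorem isEffectiveMatrix_effectiveMatrix {ω : Set Plane} (hω : MeasurableSet ω)
    {A₁ A₂ : Matrix (Fin 2) (Fin 2) ℝ} {z₁ z₂ : ℂ} (h₁ : ActsAs A₁ z₁) (h₂ : ActsAs A₂ z₂)
    (hz₁ : 0 < z₁.re) (hz₂ : 0 < z₂.re) :
    IsEffectiveMatrix (twoPhase ω A₁ A₂) (effectiveMatrix (twoPhase ω A₁ A₂)) :=
  Classical.epsilon_spec (exists_isEffectiveMatrix hω h₁ h₂ hz₁ hz₂)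

/-! ### Dykhne transformations -/

theorem I_smul_constField (c : ℂ) : Complex.I • constField c = constField (Complex.I * c) := by
  refine Lp.ext ?_
  filter_upwards [Lp.coeFn_smul Complex.I (constField c), coeFn_constField c,
    coeFn_constField (Complex.I * c)] with x h1 h2 h3
  rw [h1, Pi.smul_apply, h2, h3, smul_eq_mul]

/-- Effect of a Dykhne transformation of the coefficient on the mean field and the mean flux. -/
theorem IsMeanPair.dykhne {ω : Set Plane} (hω : MeasurableSet ω) {z₁ z₂ z₁' z₂' : ℂ} {b d : ℝ}
    (e₁ : z₁' * (1 + Complex.I * d * z₁) = z₁ + Complex.I * b)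
    (e₂ : z₂' * (1 + Complex.I * d * z₂) = z₂ + Complex.I * b) {l m : ℂ}
    (h : IsMeanPair (phaseOp hω z₁ z₂) l m) :
    IsMeanPair (phaseOp hω z₁' z₂') (l + Complex.I * d * m) (m + Complex.I * b * l) := by
  obtain ⟨v, hv, w, hw, e⟩ := h
  refine ⟨v - d • w, gradSpace.sub_mem hv (gradSpace.smul_mem d hw), w + b • v,
    gradSpace.add_mem hw (gradSpace.smul_mem b hv), ?_⟩
  set g := constField l + v with hg
  have hI : Complex.I • (Complex.I • w) = -w := by
    rw [smul_smul, Complex.I_mul_I, neg_smul, one_smul]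
  -- The new field is `g + i d f` with `f` the old flux: since `i² = -1`, the rotated gradient in
  -- the flux becomes a gradient. The new flux is `f + i b g`.
  have hl : constField (l + Complex.I * d * m) + (v - d • w)
      = g + Complex.I • (d • phaseOp hω z₁ z₂ g) := by
    rw [e, smul_comm, smul_add, I_smul_constField, hI, map_add, hg,
      show Complex.I * d * m = d • (Complex.I * m) by rw [Complex.real_smul]; ring, map_smul]
    module
  have hr : constField (m + Complex.I * b * l) + Complex.I • (w + b • v)
      = phaseOp hω z₁ z₂ g + Complex.I • (b • g) := by
    rw [e, hg, smul_add b, smul_add, smul_add, smul_comm Complex.I b (constField l),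
      I_smul_constField, map_add,
      show Complex.I * b * l = b • (Complex.I * l) by rw [Complex.real_smul]; ring, map_smul]
    module
  rw [hl, hr]
  set f := phaseOp hω z₁ z₂ g with hf
  refine Lp.ext ?_
  filter_upwards [coeFn_phaseOp hω z₁' z₂' (g + Complex.I • (d • f)),
    Lp.coeFn_add g (Complex.I • (d • f)), Lp.coeFn_smul Complex.I (d • f), Lp.coeFn_smul d f,
    Lp.coeFn_add f (Complex.I • (b • g)), Lp.coeFn_smul Complex.I (b • g), Lp.coeFn_smul b g,
    coeFn_phaseOp hω z₁ z₂ g] with x t1 t2 t3 t4 t5 t6 t7 t8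
  rw [t1, t2, t5, Pi.add_apply, Pi.add_apply, t3, t6, Pi.smul_apply, Pi.smul_apply, t4, t7,
    Pi.smul_apply, Pi.smul_apply, hf, t8, Complex.real_smul, Complex.real_smul, smul_eq_mul,
    smul_eq_mul]
  by_cases hx : x ∈ ω
  · rw [phaseFun_of_mem hx, phaseFun_of_mem hx]
    linear_combination g x * e₂
  · rw [phaseFun_of_notMem hx, phaseFun_of_notMem hx]
    linear_combination g x * e₁

/-- The effective matrix of a two-phase material with Hall effect, in terms of the one of the
field-free material obtained by a Dykhne transformation. -/
theorem effectiveMatrix_dykhne {ω : Set Plane} (hω : MeasurableSet ω) {α₁ β₁ α₂ β₂ h d γ : ℝ}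
    (hα₁ : 0 < α₁) (hα₂ : 0 < α₂) (hγ : 0 < γ)
    (hre : γ * (1 - d * (h * (β₂ - β₁))) = α₂)
    (him : γ * (d * α₂) = h * (β₂ - β₁) + d * α₁ ^ 2)
    {A₀ : Matrix (Fin 2) (Fin 2) ℝ}
    (hA₀ : A₀ = effectiveMatrix (twoPhase ω (phase α₁ β₁ h) (phase α₂ β₂ h)) - (h * β₁) • rotJ) :
    effectiveMatrix (fieldFree ω α₁ γ) * (1 + d • (rotJ * A₀)) = A₀ + (d * α₁ ^ 2) • rotJ := by
  have hA := isEffectiveMatrix_effectiveMatrix hω (actsAs_phase α₁ β₁ h) (actsAs_phase α₂ β₂ h)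
    hα₁ hα₂
  have hA' : IsEffectiveMatrix (fieldFree ω α₁ γ) (effectiveMatrix (fieldFree ω α₁ γ)) :=
    isEffectiveMatrix_effectiveMatrix hω (actsAs_smul_one α₁) (actsAs_smul_one γ)
      (by simpa using hα₁) (by simpa using hγ)
  refine Matrix.ext_iff_mulVec.2 fun l => toC_injective ?_
  have p1 := hA.isMeanPair hω (actsAs_phase α₁ β₁ h) (actsAs_phase α₂ β₂ h) l
  -- With `d = 0` the transformation only subtracts the constant `h β₁ J`, which makes the first
  -- phase real.
  have p2 := p1.dykhne hω (z₁' := α₁) (z₂' := ⟨α₂, h * (β₂ - β₁)⟩) (b := -(h * β₁)) (d := 0)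
    (by apply Complex.ext <;> simp) (by apply Complex.ext <;> simp; ring)
  -- The choice `b = d α₁²` fixes `α₁`; `hre` and `him` are the real and imaginary parts of the
  -- condition that the second phase becomes `γ`.
  have p3 := p2.dykhne hω (z₁' := α₁) (z₂' := γ) (b := d * α₁ ^ 2) (d := d)
    (by apply Complex.ext <;> simp [-Complex.ofReal_pow]; ring)
    (by
      apply Complex.ext
      · simp [-Complex.ofReal_pow]; linarith
      · simp [-Complex.ofReal_pow]; linarith)
  have p4 := hA'.isMeanPair hω (actsAs_smul_one α₁) (actsAs_smul_one γ) ((1 + d • (rotJ * A₀)) *ᵥ l)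
  have hm : toC (A₀ *ᵥ l) = toC (effectiveMatrix (twoPhase ω (phase α₁ β₁ h) (phase α₂ β₂ h)) *ᵥ l)
      + Complex.I * (-(h * β₁) : ℝ) * toC l := by
    rw [hA₀, sub_mulVec, smul_mulVec, sub_eq_add_neg, ← neg_smul, toC_add, toC_smul, actsAs_rotJ,
      Complex.real_smul]
    ring
  have hl : toC ((1 + d • (rotJ * A₀)) *ᵥ l)
      = toC l + Complex.I * d * toC (A₀ *ᵥ l) := by
    rw [add_mulVec, one_mulVec, smul_mulVec, ← mulVec_mulVec, toC_add, toC_smul, actsAs_rotJ,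
      Complex.real_smul]
    ring
  rw [← hm] at p3
  simp only [Complex.ofReal_zero, mul_zero, zero_mul, add_zero] at p3
  rw [hl] at p4
  have hco : CoerciveOp (phaseOp hω (α₁ : ℂ) (γ : ℂ)) :=
    coerciveOp_phaseOp hω (by simpa using hα₁) (by simpa using hγ)
  rw [← mulVec_mulVec, hco.isMeanPair_unique p4 p3, add_mulVec, smul_mulVec, toC_add, toC_smul,
    actsAs_rotJ, Complex.real_smul]
  ring

/-! ### Stability under small transformations -/

theorem BoundedSeq.mul {A B : ℕ → Matrix (Fin 2) (Fin 2) ℝ} (hA : BoundedSeq A)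
    (hB : BoundedSeq B) : BoundedSeq fun n => A n * B n := by
  obtain ⟨C, hC⟩ := hA
  obtain ⟨D, hD⟩ := hB
  refine ⟨C * D + C * D, fun n i j => ?_⟩
  have hC0 : 0 ≤ C := (abs_nonneg _).trans (hC 0 0 0)
  change |(A n * B n) i j| ≤ _
  rw [mul_apply, Fin.sum_univ_two]
  refine (abs_add_le _ _).trans (add_le_add ?_ ?_) <;> rw [abs_mul] <;>
    exact mul_le_mul (hC _ _ _) (hD _ _ _) (abs_nonneg _) hC0

theorem BoundedSeq.tendsto_smul {A : ℕ → Matrix (Fin 2) (Fin 2) ℝ} (hA : BoundedSeq A)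
    {d : ℕ → ℝ} (hd : Tendsto d atTop (𝓝 0)) : Tendsto (fun n => d n • A n) atTop (𝓝 0) := by
  obtain ⟨C, hC⟩ := hA
  refine tendsto_pi_nhds.2 fun i => tendsto_pi_nhds.2 fun j => ?_
  have h : Tendsto (fun n => |d n| * C) atTop (𝓝 0) := by simpa using hd.abs.mul_const C
  refine squeeze_zero_norm (fun n => ?_) h
  rw [Matrix.smul_apply, smul_eq_mul, norm_mul]
  exact mul_le_mul_of_nonneg_left (hC n i j) (norm_nonneg _)

theorem boundedSeq_const (M : Matrix (Fin 2) (Fin 2) ℝ) : BoundedSeq fun _ => M :=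
  ⟨∑ i, ∑ j, |M i j|, fun _ i j =>
    (Finset.single_le_sum (f := fun j => |M i j|) (fun _ _ => abs_nonneg _)
      (Finset.mem_univ j)).trans
    (Finset.single_le_sum (f := fun i => ∑ j, |M i j|)
      (fun _ _ => Finset.sum_nonneg fun _ _ => abs_nonneg _) (Finset.mem_univ i))⟩

/-- A Dykhne transformation with small parameters changes a bounded sequence little. -/
theorem tendsto_sub_of_dykhne {A A' : ℕ → Matrix (Fin 2) (Fin 2) ℝ} {b d : ℕ → ℝ}
    (hA' : BoundedSeq A') (hb : Tendsto b atTop (𝓝 0)) (hd : Tendsto d atTop (𝓝 0))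
    (h : ∀ n, A' n * (1 + d n • (rotJ * A n)) = A n + b n • rotJ) :
    Tendsto (fun n => A n - A' n) atTop (𝓝 0) := by
  have hAJ := hA'.mul (boundedSeq_const rotJ)
  set E : ℕ → Matrix (Fin 2) (Fin 2) ℝ := fun n => 1 - d n • (A' n * rotJ) with hE
  set F : ℕ → Matrix (Fin 2) (Fin 2) ℝ :=
    fun n => d n • (A' n * rotJ * A' n) - b n • rotJ with hF
  have hEt : Tendsto E atTop (𝓝 1) := by
    simpa using (tendsto_const_nhds (x := (1 : Matrix (Fin 2) (Fin 2) ℝ))).sub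
      (hAJ.tendsto_smul hd)
  have hFt : Tendsto F atTop (𝓝 0) := by
    simpa using ((hAJ.mul hA').tendsto_smul hd).sub
      ((boundedSeq_const rotJ).tendsto_smul hb)
  -- Only `A'` is known to be bounded, so the relation is solved for `A - A'` with coefficients `E`
  -- and `F` involving `A'` alone.
  have hEF : ∀ n, E n * (A n - A' n) = F n := by
    intro n
    have hn := h n
    rw [mul_add, mul_one, mul_smul_comm, ← mul_assoc] at hn
    simp only [hE, hF, sub_mul, one_mul, mul_sub, smul_mul_assoc]
    have hn' : A n - d n • (A' n * rotJ * A n) = A' n - b n • rotJ :=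
      sub_eq_sub_iff_add_eq_add.2 hn.symm
    rw [hn']
    abel
  have hdet : Tendsto (fun n => (E n).det) atTop (𝓝 1) := by
    have := ((continuous_id.matrix_det (n := Fin 2) (R := ℝ)).tendsto 1).comp hEt
    simpa [Function.comp_def] using this
  have hadj : Tendsto (fun n => (E n).adjugate) atTop (𝓝 1) := by
    have := ((continuous_id.matrix_adjugate (n := Fin 2) (R := ℝ)).tendsto 1).comp hEt
    simpa [Function.comp_def] using this
  -- The inverse of `E` is written as adjugate over determinant; both converge, and the determinant
  -- is eventually nonzero.
  have hlim : Tendsto (fun n => ((E n).det)⁻¹ • ((E n).adjugate * F n)) atTop (𝓝 0) := by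
    simpa using (hdet.inv₀ one_ne_zero).smul (hadj.mul hFt)
  refine hlim.congr' ?_
  filter_upwards [hdet.eventually_ne one_ne_zero] with n hn
  rw [← hEF, ← mul_assoc, adjugate_mul, smul_mul_assoc, one_mul, smul_smul, inv_mul_cancel₀ hn,
    one_smul]

/-! ### Choice and asymptotics of the Dykhne parameter -/

/-- The linear coefficient of the quadratic equation for the Dykhne parameter. -/
def dykhneGap (α a b : ℝ) : ℝ := a ^ 2 + b ^ 2 - α ^ 2

/-- The small root of the quadratic equation that makes both phases real. -/
def dykhneParam (α a b : ℝ) : ℝ :=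
  2 * b / (dykhneGap α a b + √(dykhneGap α a b ^ 2 + 4 * α ^ 2 * b ^ 2))

/-- Eliminating `γ` from `γ (1 - d b) = a` and `γ d a = b + d α²` gives `α² b d² + D d - b = 0`,
with `D` the gap. The root `(R - D) / (2 α² b)` is used in the rationalized form `2 b / (D + R)`,
which also covers `b = 0`. -/
theorem dykhneParam_quadratic {α : ℝ} (hα : 0 < α) (a b : ℝ) :
    (b + dykhneParam α a b * α ^ 2) * (1 - dykhneParam α a b * b) = a ^ 2 * dykhneParam α a b := by
  rcases eq_or_ne b 0 with rfl | hb
  · simp [dykhneParam]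
  set D := dykhneGap α a b with hD
  set R := √(D ^ 2 + 4 * α ^ 2 * b ^ 2) with hR
  have hR2 : R ^ 2 = D ^ 2 + 4 * α ^ 2 * b ^ 2 := Real.sq_sqrt (by positivity)
  have hR0 : 0 ≤ R := Real.sqrt_nonneg _
  have hpos : 0 < 4 * α ^ 2 * b ^ 2 := by positivity
  have hne : D + R ≠ 0 := by
    intro h0
    have : R = -D := by linarith
    rw [this] at hR2
    nlinarith
  have hd : dykhneParam α a b = 2 * b / (D + R) := rfl
  have ha : a ^ 2 = D - b ^ 2 + α ^ 2 := by rw [hD, dykhneGap]; ring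
  rw [hd, ha]
  field_simp
  linear_combination hR2

/-- The conductivity of the second phase after the Dykhne transformation. -/
def dykhnePhase (α a b : ℝ) : ℝ :=
  a * (1 + dykhneParam α a b ^ 2 * α ^ 2)
    / ((1 - dykhneParam α a b * b) ^ 2 + (dykhneParam α a b * a) ^ 2)

theorem dykhne_denom_pos (α : ℝ) {a : ℝ} (ha : 0 < a) (b : ℝ) :
    0 < (1 - dykhneParam α a b * b) ^ 2 + (dykhneParam α a b * a) ^ 2 := by
  rcases eq_or_ne (dykhneParam α a b) 0 with h | h
  · simp [h]
  · positivity

theorem dykhnePhase_pos (α : ℝ) {a : ℝ} (ha : 0 < a) (b : ℝ) : 0 < dykhnePhase α a b :=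
  div_pos (by positivity) (dykhne_denom_pos α ha b)

/-- `dykhnePhase` is the real part of the transformed coefficient, a form in which positivity is
visible. The quadratic equation says that the imaginary part vanishes, so the real part is the whole
coefficient. -/
theorem dykhnePhase_re {α a : ℝ} (hα : 0 < α) (ha : 0 < a) (b : ℝ) :
    dykhnePhase α a b * (1 - dykhneParam α a b * b) = a := by
  have hq := dykhneParam_quadratic hα a b
  have hN := dykhne_denom_pos α ha b
  rw [dykhnePhase]
  set d := dykhneParam α a b
  rw [div_mul_eq_mul_div, div_eq_iff hN.ne']
  linear_combination a * d * hq

theorem dykhnePhase_im {α a : ℝ} (hα : 0 < α) (ha : 0 < a) (b : ℝ) :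
    dykhnePhase α a b * (dykhneParam α a b * a) = b + dykhneParam α a b * α ^ 2 := by
  have hq := dykhneParam_quadratic hα a b
  have hN := dykhne_denom_pos α ha b
  rw [dykhnePhase]
  set d := dykhneParam α a b
  rw [div_mul_eq_mul_div, div_eq_iff hN.ne']
  linear_combination (-(1 + d ^ 2 * α ^ 2) + d * (b + d * α ^ 2)) * hq

/-- After division by `a²`, both the gap and the square root tend to `1 + t²`, while the numerator
`2 b a` becomes `2 b / a → 2 t`. -/
theorem tendsto_dykhneParam_mul (α : ℝ) {a b : ℕ → ℝ} {t : ℝ} (ha0 : ∀ n, 0 < a n)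
    (ha : Tendsto a atTop atTop) (hb : Tendsto (fun n => b n / a n) atTop (𝓝 t)) :
    Tendsto (fun n => dykhneParam α (a n) (b n) * a n) atTop (𝓝 (t / (1 + t ^ 2))) := by
  have hinv : Tendsto (fun n => α / a n) atTop (𝓝 0) := ha.const_div_atTop α
  have hD : Tendsto (fun n => 1 + (b n / a n) ^ 2 - (α / a n) ^ 2) atTop (𝓝 (1 + t ^ 2)) := by
    simpa using ((tendsto_const_nhds (x := (1 : ℝ))).add (hb.pow 2)).sub (hinv.pow 2)
  have hR : Tendsto (fun n => √((1 + (b n / a n) ^ 2 - (α / a n) ^ 2) ^ 2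
      + 4 * (α / a n) ^ 2 * (b n / a n) ^ 2)) atTop (𝓝 (1 + t ^ 2)) := by
    have h := ((hD.pow 2).add (((hinv.pow 2).const_mul 4).mul (hb.pow 2))).sqrt
    have e : √((1 + t ^ 2) ^ 2 + 4 * (0 : ℝ) ^ 2 * t ^ 2) = 1 + t ^ 2 := by
      rw [show (1 + t ^ 2) ^ 2 + 4 * (0 : ℝ) ^ 2 * t ^ 2 = (1 + t ^ 2) ^ 2 by ring]
      exact Real.sqrt_sq (by positivity)
    rwa [e] at h
  have h := (hb.const_mul 2).div (hD.add hR) (by positivity)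
  have e : 2 * t / (1 + t ^ 2 + (1 + t ^ 2)) = t / (1 + t ^ 2) := by
    have : (1 + t ^ 2 : ℝ) ≠ 0 := by positivity
    field_simp
    ring
  rw [e] at h
  refine h.congr fun n => ?_
  have han := ha0 n
  have h1 : 1 + (b n / a n) ^ 2 - (α / a n) ^ 2 = dykhneGap α (a n) (b n) / a n ^ 2 := by
    rw [dykhneGap]; field_simp
  have h2 : √((1 + (b n / a n) ^ 2 - (α / a n) ^ 2) ^ 2
      + 4 * (α / a n) ^ 2 * (b n / a n) ^ 2)
      = √(dykhneGap α (a n) (b n) ^ 2 + 4 * α ^ 2 * b n ^ 2) / a n ^ 2 := by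
    rw [h1, show (dykhneGap α (a n) (b n) / a n ^ 2) ^ 2 + 4 * (α / a n) ^ 2 * (b n / a n) ^ 2
      = (dykhneGap α (a n) (b n) ^ 2 + 4 * α ^ 2 * b n ^ 2) / (a n ^ 2) ^ 2 by field_simp,
      Real.sqrt_div' _ (by positivity), Real.sqrt_sq (by positivity)]
  rw [Pi.div_apply, h2, h1, ← add_div, dykhneParam]
  rw [div_div_eq_mul_div, div_mul_eq_mul_div]
  congr 1
  field_simp

theorem tendsto_dykhneParam (α : ℝ) {a b : ℕ → ℝ} {t : ℝ} (ha0 : ∀ n, 0 < a n)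
    (ha : Tendsto a atTop atTop) (hb : Tendsto (fun n => b n / a n) atTop (𝓝 t)) :
    Tendsto (fun n => dykhneParam α (a n) (b n)) atTop (𝓝 0) := by
  refine ((tendsto_dykhneParam_mul α ha0 ha hb).div_atTop ha).congr fun n => ?_
  exact mul_div_cancel_right₀ _ (ha0 n).ne'

/-- Here `d → 0`, `d a → t / (1 + t²)` and `d b → t² / (1 + t²)`, so the denominator in
`dykhnePhase` tends to `1 / (1 + t²)`. -/
theorem tendsto_dykhnePhase_div (α : ℝ) {a b : ℕ → ℝ} {t : ℝ} (ha0 : ∀ n, 0 < a n)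
    (ha : Tendsto a atTop atTop) (hb : Tendsto (fun n => b n / a n) atTop (𝓝 t)) :
    Tendsto (fun n => dykhnePhase α (a n) (b n) / a n) atTop (𝓝 (1 + t ^ 2)) := by
  have hda := tendsto_dykhneParam_mul α ha0 ha hb
  have hd := tendsto_dykhneParam α ha0 ha hb
  have hdb : Tendsto (fun n => dykhneParam α (a n) (b n) * b n) atTop
      (𝓝 (t / (1 + t ^ 2) * t)) := by
    refine (hda.mul hb).congr fun n => ?_
    have := (ha0 n).ne'
    field_simp
  have hp : (1 + t ^ 2 : ℝ) ≠ 0 := by positivity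
  have e0 : (1 - t / (1 + t ^ 2) * t) ^ 2 + (t / (1 + t ^ 2)) ^ 2 = 1 / (1 + t ^ 2) := by
    field_simp
    ring
  have h := ((tendsto_const_nhds (x := (1 : ℝ))).add ((hd.pow 2).mul_const (α ^ 2))).div
    (((tendsto_const_nhds (x := (1 : ℝ)).sub hdb).pow 2).add (hda.pow 2))
    (by rw [e0]; positivity)
  rw [e0] at h
  have e1 : (1 + (0 : ℝ) ^ 2 * α ^ 2) / (1 / (1 + t ^ 2)) = 1 + t ^ 2 := by
    field_simp
    ring
  rw [e1] at h
  refine h.congr fun n => ?_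
  have := (ha0 n).ne'
  rw [dykhnePhase, Pi.div_apply, div_right_comm, mul_div_cancel_left₀ _ this]

end

end Hall

/-! ### The asymptotic formula for the Hall effect -/

theorem mainTheorem6
    (ω : ℕ → Set Hall.Plane) (hω : ∀ n, MeasurableSet (ω n)) (hωY : ∀ n, ω n ⊆ Hall.cell)
    (α₁ α₂ β₁ β₂ : ℝ) (hα₁ : 0 < α₁) (hα₂ : 0 < α₂)
    (α₂n β₂n : ℕ → ℝ) (hα₂n : ∀ n, 0 < α₂n n)
    (hlim_α : Tendsto α₂n atTop atTop)
    (hliminf_β : 0 < liminf (fun n => ((|β₂n n - β₁| : ℝ) : EReal)) atTop)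
    (hlim_βα : Tendsto (fun n => β₂n n / α₂n n) atTop (𝓝 (β₂ / α₂)))
    (hbdd : ∀ (γ₁n γ₂n : ℕ → ℝ) (γ₂ : ℝ), (∀ n, 0 < γ₁n n) → (∀ n, 0 < γ₂n n) → 0 < γ₂ →
      Tendsto γ₁n atTop (𝓝 α₁) → Tendsto (fun n => γ₂n n / α₂n n) atTop (𝓝 γ₂) →
      Hall.BoundedSeq fun n => Hall.effectiveMatrix (Hall.fieldFree (ω n) (γ₁n n) (γ₂n n))) :
    ∃ α₁' α₂' : ℝ → ℕ → ℝ, ∀ h : ℝ,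
      (∀ n, 0 < α₁' h n) ∧ (∀ n, 0 < α₂' h n) ∧
      Tendsto (α₁' h) atTop (𝓝 α₁) ∧
      Asymptotics.IsEquivalent atTop (α₂' h)
        (fun n => (α₂ ^ 2 + h ^ 2 * β₂ ^ 2) / α₂ ^ 2 * α₂n n) ∧
      -- the two effective matrices below are well defined through their cell problems
      (∀ n, Hall.IsEffectiveMatrix
        (Hall.twoPhase (ω n) (Hall.phase α₁ β₁ h) (Hall.phase (α₂n n) (β₂n n) h))
        (Hall.effectiveMatrix
          (Hall.twoPhase (ω n) (Hall.phase α₁ β₁ h) (Hall.phase (α₂n n) (β₂n n) h)))) ∧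
      (∀ n, Hall.IsEffectiveMatrix (Hall.fieldFree (ω n) (α₁' h n) (α₂' h n))
        (Hall.effectiveMatrix (Hall.fieldFree (ω n) (α₁' h n) (α₂' h n)))) ∧
      Tendsto (fun n =>
        Hall.effectiveMatrix
            (Hall.twoPhase (ω n) (Hall.phase α₁ β₁ h) (Hall.phase (α₂n n) (β₂n n) h))
          - (Hall.effectiveMatrix (Hall.fieldFree (ω n) (α₁' h n) (α₂' h n))
              + (h * β₁) • Hall.rotJ)) atTop (𝓝 0) ∧
      Hall.BoundedSeq fun n =>
        Hall.effectiveMatrix (Hall.fieldFree (ω n) (α₁' h n) (α₂' h n)) := by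
  -- The first phase is kept exactly; `h (β₂n - β₁)` is the Hall coefficient left in the second
  -- phase once `h β₁ J` is subtracted.
  refine ⟨fun _ _ => α₁, fun h n => Hall.dykhnePhase α₁ (α₂n n) (h * (β₂n n - β₁)), fun h => ?_⟩
  have hpos := fun n => Hall.dykhnePhase_pos α₁ (hα₂n n) (h * (β₂n n - β₁))
  have hb : Tendsto (fun n => h * (β₂n n - β₁) / α₂n n) atTop (𝓝 (h * (β₂ / α₂))) := by
    have h1 := (hlim_βα.sub (hlim_α.const_div_atTop β₁)).const_mul h
    rw [sub_zero] at h1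
    refine h1.congr fun n => ?_
    ring
  have hdiv := Hall.tendsto_dykhnePhase_div α₁ hα₂n hlim_α hb
  have hd := Hall.tendsto_dykhneParam α₁ hα₂n hlim_α hb
  -- The boundedness hypothesis is applied with limit ratio `γ₂ = 1 + (h β₂ / α₂)²`.
  have hbound := hbdd (fun _ => α₁) _ _ (fun _ => hα₁) hpos (by positivity) tendsto_const_nhds hdiv
  have hc : (α₂ ^ 2 + h ^ 2 * β₂ ^ 2) / α₂ ^ 2 = 1 + (h * (β₂ / α₂)) ^ 2 := by
    field_simp
  refine ⟨fun _ => hα₁, hpos, tendsto_const_nhds, ?_, fun n => ?_, fun n => ?_, ?_, hbound⟩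
  · rw [hc]
    have hne : (1 + (h * (β₂ / α₂)) ^ 2 : ℝ) ≠ 0 := by positivity
    refine Asymptotics.isEquivalent_of_tendsto_one ?_
    have h1 := hdiv.div_const (1 + (h * (β₂ / α₂)) ^ 2)
    rw [div_self hne] at h1
    refine h1.congr fun n => ?_
    rw [Pi.div_apply, div_div, mul_comm (α₂n n)]
  · exact Hall.isEffectiveMatrix_effectiveMatrix (hω n) (Hall.actsAs_phase α₁ β₁ h)
      (Hall.actsAs_phase (α₂n n) (β₂n n) h) hα₁ (hα₂n n)
  · exact Hall.isEffectiveMatrix_effectiveMatrix (hω n) (Hall.actsAs_smul_one α₁)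
      (Hall.actsAs_smul_one _) (by simpa using hα₁) (by simpa using hpos n)
  · have hlim := Hall.tendsto_sub_of_dykhne hbound
      (by simpa using hd.mul_const (α₁ ^ 2)) hd
      fun n => Hall.effectiveMatrix_dykhne (hω n) hα₁ (hα₂n n) (hpos n)
        (Hall.dykhnePhase_re hα₁ (hα₂n n) _) (Hall.dykhnePhase_im hα₁ (hα₂n n) _) rfl
    refine hlim.congr fun n => ?_
    abel
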